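/- Let $M$ be a compact smooth manifold (without boundary), let $T>0$, and let $g(t)$, $t\in I=[0,T]$, be a Ricci flow on $M$: a family of Riemannian metrics, smooth on $M\times I$, with $\partial g/\partial t=-2\,\mathrm{Ric}_{g}$. A \emph{curve-shrinking flow} in $(M,g(t))$ is a smooth map $c\colon S^1\times I\to M$ such that each $c(\cdot,t)$ is an immersion and $$\frac{\partial c}{\partial t}(x,t)=H(x,t),\qquad H=\nabla^{g(t)}_SS,$$ where $X=\partial c/\partial x$ and $S=X/|X|_{g(t)}$ is the unit tangent vector. Let $k=|H|_{g(t)}$ be the curvature and $ds=|X|_{g(t)}\,dx$ the arc-length element, and let $$L(t)=\int_{S^1}ds,\qquad \Theta(t)=\int_{S^1}k\,ds$$ be the length and the total curvature of $c(\cdot,t)$. There is a constant $C_1\ge 0$, depending only on the ambient Ricci flow $(M,g(t))_{t\in I}$, such that for every upper bound $C_2$ of $|\mathrm{Ric}_{g}|$ over $M\times I$ and every curve-shrinking flow $c$ in $(M,g(t))$ the following hold for all $t\in I$. 1. $L$ is differentiable on $I$ and $\dfrac{dL}{dt}\le\displaystyle\int_{S^1}(C_2-k^2)\,ds$. 2.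 $\Theta$ is continuous on $I$ and $\dfrac{d\Theta}{dt}\le (C_1+C_2)\,\Theta+C_1L$. Since $k$ need not be differentiable where it vanishes, $\Theta$ may fail to be differentiable, and this inequality is understood as $$\limsup_{s\to t,\ s\in I\setminus\{t\}}\frac{\Theta(s)-\Theta(t)}{s-t}\le (C_1+C_2)\,\Theta(t)+C_1L(t),$$ which is the stated inequality wherever $\Theta$ is differentiable. 3. $L(t)\le L(0)\,e^{C_2t}$. 4. $\Theta(t)+L(t)\le\bigl(\Theta(0)+L(0)\bigr)e^{(C_1+C_2)t}$. At the ends of $I$ the derivatives are one-sided. -/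

import Mathlib

open Set Filter Topology
open scoped Manifold ContDiff

noncomputable section

namespace RicciCSF

/-- The coordinate space `ℝⁿ`. -/
abbrev Coord (n : ℕ) : Type := EuclideanSpace ℝ (Fin n)

/-! ### Riemannian geometry in a coordinate domain of `ℝⁿ`

A metric in coordinates is a field `G` of bilinear forms, `G y v w = gᵢⱼ(y) vⁱ wʲ`. -/

/-- The Christoffel symbols as a bilinear field, `Γ(v, w)ᵏ = Γᵏᵢⱼ vⁱ wʲ`, defined by
`G(Γ(v, w), z) = ½ (D_v G(w, z) + D_w G(v, z) - D_z G(v, w))` for all `z`. The form `G y` is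
inverted as a map from vectors to covectors. -/
def christoffel {n : ℕ} (G : Coord n → Coord n →L[ℝ] Coord n →L[ℝ] ℝ)
    (y v w : Coord n) : Coord n :=
  (G y).inverse ((1 / 2 : ℝ) •
    (fderiv ℝ G y v w + fderiv ℝ G y w v - ((fderiv ℝ G y).flip v).flip w))

/-- The Riemann curvature operator
`R(u, v) w = D_u Γ(v, w) - D_v Γ(u, w) + Γ(u, Γ(v, w)) - Γ(v, Γ(u, w))`. -/
def riemann {n : ℕ} (G : Coord n → Coord n →L[ℝ] Coord n →L[ℝ] ℝ)
    (y u v w : Coord n) : Coord n :=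
  fderiv ℝ (fun z => christoffel G z v w) y u - fderiv ℝ (fun z => christoffel G z u w) y v
    + christoffel G y u (christoffel G y v w) - christoffel G y v (christoffel G y u w)

/-- The Ricci tensor `Ric(v, w)`, the trace of `u ↦ R(u, v) w`. -/
def ricci {n : ℕ} (G : Coord n → Coord n →L[ℝ] Coord n →L[ℝ] ℝ) (y v w : Coord n) : ℝ :=
  ∑ i : Fin n, riemann G y (EuclideanSpace.single i 1) v w i

/-- The unit tangent vector `S = γ' / |γ'|` of a curve `γ` in a coordinate domain. -/
def unitTangent {n : ℕ} (G : Coord n → Coord n →L[ℝ] Coord n →L[ℝ] ℝ) (γ : ℝ → Coord n)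
    (x : ℝ) : Coord n :=
  (√(G (γ x) (deriv γ x) (deriv γ x)))⁻¹ • deriv γ x

/-- The curvature vector `H = ∇_S S` of a curve `γ` in a coordinate domain:
`Hᵏ = dSᵏ/ds + Γᵏᵢⱼ Sⁱ Sʲ`, where `d/ds = |γ'|⁻¹ d/dx`. -/
def curvatureVector {n : ℕ} (G : Coord n → Coord n →L[ℝ] Coord n →L[ℝ] ℝ) (γ : ℝ → Coord n)
    (x : ℝ) : Coord n :=
  (√(G (γ x) (deriv γ x) (deriv γ x)))⁻¹ • deriv (unitTangent G γ) x
    + christoffel G (γ x) (unitTangent G γ x) (unitTangent G γ x)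

/-! ### Families of metrics on a manifold -/

section Manifold

variable {n : ℕ} {M : Type*} [TopologicalSpace M] [ChartedSpace (Coord n) M]
  [IsManifold (𝓡 n) ∞ M]

/-- Smooth Riemannian metrics on `M`. -/
abbrev Metric (n : ℕ) (M : Type*) [TopologicalSpace M] [ChartedSpace (Coord n) M]
    [IsManifold (𝓡 n) ∞ M] : Type _ :=
  Bundle.ContMDiffRiemannianMetric (𝓡 n) ∞ (Coord n) (fun q : M => TangentSpace (𝓡 n) q)

/-- The derivative of the inverse of the chart at `p`, from `ℝⁿ` to the tangent space of `M`, which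
Mathlib defines as a copy of `ℝⁿ`. -/
def chartFrame (p : M) (y : Coord n) : Coord n →L[ℝ] Coord n :=
  mfderiv 𝓘(ℝ, Coord n) (𝓡 n) (extChartAt (𝓡 n) p).symm y

/-- The metric `g` in the coordinates of the chart at `p`: its pullback under the inverse chart. -/
def chartMetric (g : Metric n M) (p : M) (y : Coord n) : Coord n →L[ℝ] Coord n →L[ℝ] ℝ :=
  let B : Coord n →L[ℝ] Coord n →L[ℝ] ℝ := g.inner ((extChartAt (𝓡 n) p).symm y)
  B.bilinearComp (chartFrame p y) (chartFrame p y)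

/-- `g(t)`, `t ∈ [0, T]`, is a Ricci flow: a family of metrics, smooth on `M × [0, T]`, with
`∂g/∂t = -2 Ric` (one-sided derivatives at the ends of `[0, T]`). -/
structure IsRicciFlow (g : ℝ → Metric n M) (T : ℝ) : Prop where
  smooth : ∀ p : M, ContDiffOn ℝ ∞ (fun z : Coord n × ℝ => chartMetric (g z.2) p z.1)
    ((extChartAt (𝓡 n) p).target ×ˢ Icc 0 T)
  evolution : ∀ p : M, ∀ y ∈ (extChartAt (𝓡 n) p).target, ∀ t ∈ Icc 0 T, ∀ v w : Coord n,
    HasDerivWithinAt (fun τ => chartMetric (g τ) p y v w)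
      (-2 * ricci (chartMetric (g t) p) y v w) (Icc 0 T) t

/-- `|Ric| ≤ C` on `M × [0, T]`, with the operator norm that `g(t)` induces on bilinear forms
(it is at most the tensor norm). -/
def RicciBoundedBy (g : ℝ → Metric n M) (T C : ℝ) : Prop :=
  ∀ p : M, ∀ y ∈ (extChartAt (𝓡 n) p).target, ∀ t ∈ Icc 0 T, ∀ v w : Coord n,
    |ricci (chartMetric (g t) p) y v w| ≤
      C * √(chartMetric (g t) p y v v) * √(chartMetric (g t) p y w w)

/-! ### Evolving closed curves

A family of closed curves is a map `c : S¹ × ℝ → M`, of which only the times in `[0, T]` matter.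
The circle is parametrized by the angle `x`, through `x ↦ exp (i x)`. -/

/-- The curve `x ↦ c(x, t)` in the coordinates of the chart at `p`. -/
def chartCurve (c : Circle → ℝ → M) (p : M) (t x : ℝ) : Coord n :=
  extChartAt (𝓡 n) p (c (Circle.exp x) t)

/-- The tangent vector `X = ∂c/∂x`. -/
def tangentVector (c : Circle → ℝ → M) (t x : ℝ) : TangentSpace (𝓡 n) (c (Circle.exp x) t) :=
  mfderiv 𝓘(ℝ, ℝ) (𝓡 n) (fun x' : ℝ => c (Circle.exp x') t) x (1 : ℝ)

/-- The speed `|X|`, measured with `g(t)`. The arc-length element is `ds = |X| dx`. -/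
def speed (g : ℝ → Metric n M) (c : Circle → ℝ → M) (t x : ℝ) : ℝ :=
  √((g t).inner (c (Circle.exp x) t) (tangentVector c t x) (tangentVector c t x))

/-- The curvature `k = |H|` at the point with parameter `x` at time `t`, computed in the chart at
`c(x, t)`. -/
def curvature (g : ℝ → Metric n M) (c : Circle → ℝ → M) (t x : ℝ) : ℝ :=
  √(chartMetric (g t) (c (Circle.exp x) t) (chartCurve c (c (Circle.exp x) t) t x)
    (curvatureVector (chartMetric (g t) (c (Circle.exp x) t))
      (chartCurve c (c (Circle.exp x) t) t) x)
    (curvatureVector (chartMetric (g t) (c (Circle.exp x) t))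
      (chartCurve c (c (Circle.exp x) t) t) x))

/-- `c` is a solution of the curve-shrinking equation `∂c/∂t = H` in `(M, g(t))` on `[0, T]`:
a smooth map `S¹ × [0, T] → M`, an immersion of the circle at each time, which satisfies the
equation in all charts. -/
structure IsCurveShrinkingFlow (g : ℝ → Metric n M) (T : ℝ) (c : Circle → ℝ → M) : Prop where
  smooth : ContMDiffOn ((𝓡 1).prod 𝓘(ℝ, ℝ)) (𝓡 n) ∞ (fun z : Circle × ℝ => c z.1 z.2)
    (univ ×ˢ Icc 0 T)
  immersed : ∀ t ∈ Icc 0 T, ∀ x : ℝ, tangentVector (n := n) c t x ≠ 0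
  evolution : ∀ p : M, ∀ t ∈ Icc 0 T, ∀ x : ℝ,
    c (Circle.exp x) t ∈ (extChartAt (𝓡 n) p).source →
      HasDerivWithinAt (fun τ => chartCurve c p τ x)
        (curvatureVector (chartMetric (g t) p) (chartCurve c p t) x) (Icc 0 T) t

/-- The total length `L(t) = ∫ ds`. -/
def length (g : ℝ → Metric n M) (c : Circle → ℝ → M) (t : ℝ) : ℝ :=
  ∫ x in (0 : ℝ)..2 * Real.pi, speed g c t x

/-- The total curvature `Θ(t) = ∫ k ds`. -/
def totalCurvature (g : ℝ → Metric n M) (c : Circle → ℝ → M) (t : ℝ) : ℝ :=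
  ∫ x in (0 : ℝ)..2 * Real.pi, curvature g c t x * speed g c t x

end Manifold

/-- `df/dt ≤ r` at `t`, relative to `S`, for a function that may fail to be differentiable: the
limit superior of `(f(s) - f(t)) / (s - t)` as `s → t` in `S`, from either side, is at most `r`. -/
def DerivLEWithin (f : ℝ → ℝ) (r : ℝ) (S : Set ℝ) (t : ℝ) : Prop :=
  ∀ r' > r, ∀ᶠ s in 𝓝[S \ {t}] t, slope f t s < r'

end RicciCSF

end

noncomputable section

/-! Let `v = |X|` and `f = k²`. Differentiating `v² = g(X, X)` in time gives `v_t = v (½ g_t(S, S) -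
k²)`, and `g_t = -2 Ric` bounds the right side by `v (C₂ - k²)`. Integration yields the length
inequality, and Gronwall yields the exponential bound on `L`.

For the curvature, commuting covariant derivatives along the moving curve gives `f_t = f_ss - 2Q +
2f² + error`, where `Q` is the squared norm of the normal part of `∇_S H`. The error collects `g_t`,
the curvature of the connection and the time derivative of the connection. Each of its terms
contains `H` once or twice, so it is at most `A (k² + k)`, with `A` obtained from finitely many
charts of the compact manifold. This estimate needs only a smooth family of metrics; the Ricci flow
equation enters through the speed alone.

Formally `k_t ≤ k_ss + k³ + A (k + 1) / 2`. In `(k v)_t` the cubic terms cancel and `k_ss`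
integrates to zero over the closed curve, which is the inequality for `Θ`. Since `k` may fail to be
smooth at its zeros, the computation is made for `√(k² + ε²)`: Cauchy-Schwarz, `f_x² ≤ 4 v² f Q`,
lets `-2Q` absorb the gradient term that the square root produces. The resulting mean value
inequality survives `ε → 0` and gives the limsup bound on difference quotients. The bounds for `Θ`
and `L` add up to `(A + C₂)(Θ + L)`, to which Gronwall applies.

The scalar half of the argument is `IsEvolution`, with `evolution_algebra` and
`totalCurvature_sub_le`; the geometric half is `IsLocalFlow`, with `dt_speed` and
`dt_inner_dt_self`. They meet in `isEvolution`, by way of `curvature_eq`, which replaces `H` by the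
velocity `∂c/∂t`. -/

namespace RicciCSF

/-! ### Calculus on the space-time strip. -/

/-- The space-time strip `ℝ × [0, T]`. -/
def strip (T : ℝ) : Set (ℝ × ℝ) := univ ×ˢ Icc 0 T

theorem uniqueDiffOn_strip {T : ℝ} (hT : 0 < T) : UniqueDiffOn ℝ (strip T) :=
  uniqueDiffOn_univ.prod (uniqueDiffOn_Icc hT)

theorem strip_mem_nhds {T x t : ℝ} (ht : t ∈ Ioo 0 T) : strip T ∈ 𝓝 (x, t) :=
  prod_mem_nhds univ_mem (Icc_mem_nhds ht.1 ht.2)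

/-- The space derivative of a function on space-time, on the interior of the strip. -/
abbrev dx {E : Type*} [NormedAddCommGroup E] [NormedSpace ℝ E] (F : ℝ × ℝ → E) (z : ℝ × ℝ) : E :=
  fderiv ℝ F z (1, 0)

/-- The time derivative of a function on space-time, on the interior of the strip. -/
abbrev dt {E : Type*} [NormedAddCommGroup E] [NormedSpace ℝ E] (F : ℝ × ℝ → E) (z : ℝ × ℝ) : E :=
  fderiv ℝ F z (0, 1)

theorem hasDerivAt_slice_snd {E : Type*} [NormedAddCommGroup E] [NormedSpace ℝ E]
    {F : ℝ × ℝ → E} {x t : ℝ} (h : DifferentiableAt ℝ F (x, t)) :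
    HasDerivAt (fun s => F (x, s)) (dt F (x, t)) t := by
  have h1 : HasDerivAt (fun s : ℝ => (x, s)) ((0 : ℝ), (1 : ℝ)) t :=
    (hasDerivAt_const t x).prodMk (hasDerivAt_id t)
  exact h.hasFDerivAt.comp_hasDerivAt t h1

theorem hasDerivAt_slice_fst {E : Type*} [NormedAddCommGroup E] [NormedSpace ℝ E]
    {F : ℝ × ℝ → E} {x t : ℝ} (h : DifferentiableAt ℝ F (x, t)) :
    HasDerivAt (fun s => F (s, t)) (dx F (x, t)) x := by
  have h1 : HasDerivAt (fun s : ℝ => (s, t)) ((1 : ℝ), (0 : ℝ)) x :=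
    (hasDerivAt_id x).prodMk (hasDerivAt_const x t)
  exact h.hasFDerivAt.comp_hasDerivAt x h1

theorem continuous_slice_of_strip {E : Type*} [TopologicalSpace E] {F : ℝ × ℝ → E} {T t : ℝ}
    (hF : ContinuousOn F (strip T)) (ht : t ∈ Icc 0 T) : Continuous fun x => F (x, t) := by
  rw [← continuousOn_univ]
  exact hF.comp (by fun_prop) fun x _ => ⟨mem_univ _, ht⟩

/-- Freezing the time at the ends of `[0, T]` extends a function from the strip to the whole plane,
where results on parametric integrals apply. -/
theorem continuous_projIcc_of_strip {E : Type*} [TopologicalSpace E] {F : ℝ × ℝ → E} {T : ℝ}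
    (hT : 0 ≤ T) (hF : ContinuousOn F (strip T)) :
    Continuous fun z : ℝ × ℝ => F (z.1, projIcc 0 T hT z.2) := by
  rw [← continuousOn_univ]
  refine hF.comp (Continuous.continuousOn ?_) fun z _ => ⟨mem_univ _, Subtype.coe_prop _⟩
  exact continuous_fst.prodMk (continuous_subtype_val.comp (continuous_projIcc.comp continuous_snd))

/-- Integrals over a fixed interval of a continuous function on the strip depend continuously on
time. -/
theorem continuousOn_integral_of_strip {F : ℝ × ℝ → ℝ} {T : ℝ} (hT : 0 ≤ T) (a : ℝ)
    (hF : ContinuousOn F (strip T)) :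
    ContinuousOn (fun t => ∫ x in (0 : ℝ)..a, F (x, t)) (Icc 0 T) := by
  have h : Continuous fun t => ∫ x in (0 : ℝ)..a, F (x, (projIcc 0 T hT t : ℝ)) :=
    intervalIntegral.continuous_parametric_intervalIntegral_of_continuous'
      (f := fun t x => F (x, (projIcc 0 T hT t : ℝ)))
      ((continuous_projIcc_of_strip hT hF).comp continuous_swap) 0 a
  refine h.continuousOn.congr fun t ht => ?_
  simp only [projIcc_of_mem hT ht]

/-- Differentiation under the integral sign on the strip, up to its boundary. -/
theorem hasDerivWithinAt_integral_of_strip {F : ℝ × ℝ → ℝ} {T : ℝ} (hT : 0 < T) {a : ℝ}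
    (hF : ContDiffOn ℝ ∞ F (strip T)) {t : ℝ} (ht : t ∈ Icc 0 T) :
    HasDerivWithinAt (fun s => ∫ x in (0 : ℝ)..a, F (x, s))
      (∫ x in (0 : ℝ)..a, fderivWithin ℝ F (strip T) (x, t) (0, 1)) (Icc 0 T) t := by
  set F' : ℝ × ℝ → ℝ := fun z => fderivWithin ℝ F (strip T) z (0, 1) with hF'
  have hF'c : ContinuousOn F' (strip T) :=
    (hF.continuousOn_fderivWithin (uniqueDiffOn_strip hT) (by simp)).clm_apply continuousOn_const
  -- `D` is a continuous extension of the time derivative to the plane. `F` is recovered from it by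
  -- integrating in time, so the end times need no separate argument.
  set D : ℝ × ℝ → ℝ := fun z => F' (z.1, projIcc 0 T hT.le z.2) with hD
  have hDc : Continuous D := continuous_projIcc_of_strip hT.le hF'c
  have hDt : ∀ x, ∀ s ∈ Icc 0 T, D (x, s) = F' (x, s) := fun x s hs => by
    simp only [hD, projIcc_of_mem hT.le hs]
  have hslice : ∀ x, ∀ s ∈ Icc 0 T, F (x, s) - F (x, 0) = ∫ τ in (0 : ℝ)..s, D (x, τ) := by
    intro x s hs
    symm
    refine intervalIntegral.integral_eq_sub_of_hasDerivAt_of_le (f := fun τ => F (x, τ)) hs.1 ?_ ?_ ?_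
    · exact hF.continuousOn.comp (by fun_prop) fun τ hτ => ⟨mem_univ _, hτ.1, hτ.2.trans hs.2⟩
    · intro τ hτ
      have hτT : τ ∈ Ioo 0 T := ⟨hτ.1, hτ.2.trans_le hs.2⟩
      have hn := strip_mem_nhds (x := x) hτT
      rw [hDt x τ (Ioo_subset_Icc_self hτT)]
      simp only [hF', fderivWithin_of_mem_nhds hn]
      exact hasDerivAt_slice_snd ((hF.contDiffAt hn).differentiableAt (by simp))
    · exact (hDc.comp (by fun_prop : Continuous fun τ : ℝ => (x, τ))).intervalIntegrable _ _
  have hI : Continuous fun τ => ∫ x in (0 : ℝ)..a, D (x, τ) :=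
    intervalIntegral.continuous_parametric_intervalIntegral_of_continuous'
      (f := fun τ x => D (x, τ)) (hDc.comp continuous_swap) 0 a
  have hL : ∀ s ∈ Icc 0 T, ∫ x in (0 : ℝ)..a, F (x, s) =
      (∫ x in (0 : ℝ)..a, F (x, 0)) + ∫ τ in (0 : ℝ)..s, ∫ x in (0 : ℝ)..a, D (x, τ) := by
    intro s hs
    -- Fubini turns the integral of `F` into a time primitive of a continuous function.
    rw [MeasureTheory.intervalIntegral_intervalIntegral_swap]
    · rw [← intervalIntegral.integral_add]
      · refine intervalIntegral.integral_congr fun x _ => ?_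
        simp only [← hslice x s hs]; ring
      · exact (continuous_slice_of_strip hF.continuousOn ⟨le_rfl, hT.le⟩).intervalIntegrable _ _
      · exact (intervalIntegral.continuous_parametric_intervalIntegral_of_continuous'
          (f := fun x τ => D (x, τ)) hDc 0 s).intervalIntegrable _ _
    · have hc : Continuous (Function.uncurry fun τ x => D (x, τ)) := hDc.comp continuous_swap
      have hint : MeasureTheory.IntegrableOn (Function.uncurry fun τ x => D (x, τ))
          (uIcc 0 s ×ˢ uIcc 0 a) MeasureTheory.volume :=
        hc.continuousOn.integrableOn_compact (isCompact_uIcc.prod isCompact_uIcc)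
      exact hint.mono_set (Set.prod_mono uIoc_subset_uIcc uIoc_subset_uIcc)
  have hder : HasDerivAt (fun s => (∫ x in (0 : ℝ)..a, F (x, 0)) +
      ∫ τ in (0 : ℝ)..s, ∫ x in (0 : ℝ)..a, D (x, τ)) (∫ x in (0 : ℝ)..a, D (x, t)) t :=
    (intervalIntegral.integral_hasDerivAt_right (hI.intervalIntegrable _ _)
      hI.stronglyMeasurable.stronglyMeasurableAtFilter hI.continuousAt).const_add _
  have := (hder.hasDerivWithinAt (s := Icc 0 T)).congr hL (hL t ht)
  simpa only [hDt _ t ht] using this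

/-! ### Scalar evolution inequalities and their integrated consequences. -/

/-- The differential inequalities for the speed `v` and the squared curvature `f` of a
curve-shrinking flow, as functions of `(x, t)`. The quantity `Q` plays the role of the squared
norm of the normal part of `∇_S H`. -/
structure IsEvolution (T C A : ℝ) (v f : ℝ × ℝ → ℝ) : Prop where
  contDiffOn_speed : ContDiffOn ℝ ∞ v (strip T)
  contDiffOn_curv : ContDiffOn ℝ ∞ f (strip T)
  speed_pos : ∀ z ∈ strip T, 0 < v z
  curv_nonneg : ∀ z ∈ strip T, 0 ≤ f z
  periodic_speed : ∀ x, ∀ t ∈ Icc 0 T, v (x + 2 * Real.pi, t) = v (x, t)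
  periodic_curv : ∀ x, ∀ t ∈ Icc 0 T, f (x + 2 * Real.pi, t) = f (x, t)
  speed_le : ∀ x, ∀ t ∈ Ioo 0 T, dt v (x, t) ≤ v (x, t) * (C - f (x, t))
  curv_le : ∀ x, ∀ t ∈ Ioo 0 T, ∃ Q, 0 ≤ Q ∧
    dx f (x, t) ^ 2 ≤ 4 * v (x, t) ^ 2 * f (x, t) * Q ∧
    dt f (x, t) ≤ (v (x, t))⁻¹ * dx (fun w => (v w)⁻¹ * dx f w) (x, t) - 2 * Q
      + 2 * f (x, t) ^ 2 + A * (f (x, t) + √(f (x, t)))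

/-- Here `p = √(f + ε²)`, `q = √f`, and `uu` is the `x`-derivative of `v⁻¹ f_x`. The first two terms
on the right are the `x`-derivative of `v⁻¹ f_x / (2p)`. The term `-2Q` pays for `f_x²` because `f ≤
p²`, and the reaction term `v f² / p` is at most `v p f`, which `p v_t` cancels. -/
theorem evolution_algebra {v f p q Q A C vt ft fx uu : ℝ} (hv : 0 < v) (hf : 0 ≤ f) (hp : 0 < p)
    (hpf : f ≤ p ^ 2) (hqp : q ≤ p) (hQ : 0 ≤ Q) (hA : 0 ≤ A)
    (hvt : vt ≤ v * (C - f)) (hfx : fx ^ 2 ≤ 4 * v ^ 2 * f * Q)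
    (hft : ft ≤ v⁻¹ * uu - 2 * Q + 2 * f ^ 2 + A * (f + q)) :
    ft / (2 * p) * v + p * vt ≤
      uu / (2 * p) - v⁻¹ * fx ^ 2 / (4 * p ^ 3) + ((A + C) * (p * v) + A * v) := by
  have h1 : ft / (2 * p) * v ≤ uu / (2 * p) + v / p * (-Q + f ^ 2 + A / 2 * (f + q)) := by
    calc ft / (2 * p) * v ≤ (v⁻¹ * uu - 2 * Q + 2 * f ^ 2 + A * (f + q)) / (2 * p) * v := by gcongr
      _ = _ := by field_simp; ring
  have h2 : v⁻¹ * fx ^ 2 / (4 * p ^ 3) ≤ v / p * Q := by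
    calc v⁻¹ * fx ^ 2 / (4 * p ^ 3) ≤ v⁻¹ * (4 * v ^ 2 * f * Q) / (4 * p ^ 3) := by gcongr
      _ = v * f * Q / p ^ 3 := by field_simp
      _ ≤ v * p ^ 2 * Q / p ^ 3 := by gcongr
      _ = v / p * Q := by field_simp
  have h3 : v / p * f ^ 2 ≤ v * (p * f) := by
    calc v / p * f ^ 2 = v / p * f * f := by ring
      _ ≤ v / p * p ^ 2 * f := by gcongr
      _ = _ := by field_simp
  have h4 : v / p * (A / 2 * (f + q)) ≤ v * (A * p + A) := by
    calc v / p * (A / 2 * (f + q)) ≤ v / p * (A / 2 * (p ^ 2 + p)) := by gcongr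
      _ = v * (A * p + A) / 2 := by field_simp
      _ ≤ v * (A * p + A) := half_le_self (by positivity)
  have h5 : p * vt ≤ p * (v * (C - f)) := by gcongr
  linear_combination h1 + h2 + h3 + h4 + h5

namespace IsEvolution

variable {T C A : ℝ} {v f : ℝ × ℝ → ℝ}

theorem contDiffOn_reg (h : IsEvolution T C A v f) {ε : ℝ} (hε : 0 < ε) :
    ContDiffOn ℝ ∞ (fun z => √(f z + ε ^ 2)) (strip T) :=
  (h.contDiffOn_curv.add contDiffOn_const).sqrt fun z hz =>
    (add_pos_of_nonneg_of_pos (h.curv_nonneg z hz) (by positivity)).ne'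

/-- Isolates the second-order terms as the derivative of a periodic function, so that they vanish on
integration over the circle. -/
theorem reg_deriv_le (h : IsEvolution T C A v f) (hA : 0 ≤ A) {ε : ℝ} (hε : 0 < ε) {t : ℝ}
    (ht : t ∈ Ioo 0 T) :
    ∃ W : ℝ → ℝ, ContDiff ℝ 1 W ∧ W (2 * Real.pi) = W 0 ∧ ∀ x,
      dt (fun z => √(f z + ε ^ 2) * v z) (x, t) ≤
        deriv W x + ((A + C) * (√(f (x, t) + ε ^ 2) * v (x, t)) + A * v (x, t)) := by
  have htI := Ioo_subset_Icc_self ht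
  have hO : IsOpen (univ ×ˢ Ioo 0 T : Set (ℝ × ℝ)) := isOpen_univ.prod isOpen_Ioo
  have hsub : (univ ×ˢ Ioo 0 T : Set (ℝ × ℝ)) ⊆ strip T := prod_mono le_rfl Ioo_subset_Icc_self
  have hnn : ∀ x, strip T ∈ 𝓝 (x, t) := fun x => strip_mem_nhds ht
  have hdxf : ContDiffOn ℝ ∞ (dx f) (univ ×ˢ Ioo 0 T : Set (ℝ × ℝ)) :=
    ((h.contDiffOn_curv.mono hsub).fderiv_of_isOpen hO (m := ∞) (by simp)).clm_apply
      contDiffOn_const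
  have hu : ContDiffOn ℝ ∞ (fun w => (v w)⁻¹ * dx f w) (univ ×ˢ Ioo 0 T : Set (ℝ × ℝ)) :=
    ((h.contDiffOn_speed.mono hsub).inv fun z hz => (h.speed_pos z (hsub hz)).ne').mul hdxf
  have hregpos : ∀ x, 0 < f (x, t) + ε ^ 2 := fun x =>
    add_pos_of_nonneg_of_pos (h.curv_nonneg _ ⟨mem_univ _, htI⟩) (by positivity)
  have hslice : ContDiffOn ℝ ∞ (fun x : ℝ => (x, t)) univ :=
    (contDiff_id.prodMk contDiff_const).contDiffOn
  have hmaps : MapsTo (fun x : ℝ => (x, t)) univ (univ ×ˢ Ioo 0 T) := fun x _ => ⟨mem_univ _, ht⟩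
  have hdxper : ∀ x, dx f (x + 2 * Real.pi, t) = dx f (x, t) := by
    intro x
    have hd : ∀ y, HasDerivAt (fun s => f (s, t)) (dx f (y, t)) y := fun y =>
      hasDerivAt_slice_fst ((h.contDiffOn_curv.contDiffAt (hnn y)).differentiableAt (by simp))
    have h1 := (hd (x + 2 * Real.pi)).comp_add_const x (2 * Real.pi)
    have h2 : (fun s => f (s + 2 * Real.pi, t)) = fun s => f (s, t) :=
      funext fun s => h.periodic_curv s t htI
    rw [h2] at h1
    exact h1.unique (hd x)
  -- The witness is the arc-length derivative of `√(f + ε²)`.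
  refine ⟨fun x => (v (x, t))⁻¹ * dx f (x, t) / (2 * √(f (x, t) + ε ^ 2)), ?_, ?_, fun x => ?_⟩
  · rw [← contDiffOn_univ]
    refine ContDiffOn.of_le (n := ∞) ?_ (by simp)
    refine ContDiffOn.div (hu.comp hslice hmaps) (contDiffOn_const.mul
      (((h.contDiffOn_reg hε).mono hsub).comp hslice hmaps)) fun x _ => ?_
    have := Real.sqrt_pos.2 (hregpos x)
    positivity
  · have e1 := h.periodic_curv 0 t htI
    have e2 := h.periodic_speed 0 t htI
    have e3 := hdxper 0
    rw [zero_add] at e1 e2 e3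
    simp only [e1, e2, e3]
  · obtain ⟨Q, hQ, hfx, hft⟩ := h.curv_le x t ht
    have hp := Real.sqrt_pos.2 (hregpos x)
    have hz : (x, t) ∈ strip T := ⟨mem_univ _, htI⟩
    have hfd := (h.contDiffOn_curv.contDiffAt (hnn x)).differentiableAt (by simp)
    have hvd := (h.contDiffOn_speed.contDiffAt (hnn x)).differentiableAt (by simp)
    have hrd := ((h.contDiffOn_reg hε).contDiffAt (hnn x)).differentiableAt (by simp)
    have hud := (hu.contDiffAt (hO.mem_nhds (hmaps (mem_univ x)))).differentiableAt (by simp)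
    have e1 : dt (fun z => √(f z + ε ^ 2) * v z) (x, t) =
        dt f (x, t) / (2 * √(f (x, t) + ε ^ 2)) * v (x, t) +
          √(f (x, t) + ε ^ 2) * dt v (x, t) :=
      (hasDerivAt_slice_snd (hrd.mul hvd)).unique
        ((((hasDerivAt_slice_snd hfd).add_const _).sqrt (hregpos x).ne').mul
          (hasDerivAt_slice_snd hvd))
    have e2 : deriv (fun x => (v (x, t))⁻¹ * dx f (x, t) / (2 * √(f (x, t) + ε ^ 2))) x =
        dx (fun w => (v w)⁻¹ * dx f w) (x, t) / (2 * √(f (x, t) + ε ^ 2)) -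
          (v (x, t))⁻¹ * dx f (x, t) ^ 2 / (4 * √(f (x, t) + ε ^ 2) ^ 3) := by
      have := ((hasDerivAt_slice_fst hud).div ((((hasDerivAt_slice_fst hfd).add_const
        (ε ^ 2)).sqrt (hregpos x).ne').const_mul 2) (by positivity)).deriv
      refine this.trans ?_
      field_simp
      ring
    rw [e1, e2]
    refine evolution_algebra (h.speed_pos _ hz) (h.curv_nonneg _ hz) hp ?_ ?_ hQ hA
      (h.speed_le x t ht) hfx hft
    · rw [Real.sq_sqrt (hregpos x).le]; nlinarith
    · exact Real.sqrt_le_sqrt (by nlinarith)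

/-- The inequality is assumed at interior times only; both sides are continuous up to the ends of
`[0, T]`, so it passes to the closure. -/
theorem speed_deriv_le (h : IsEvolution T C A v f) (hT : 0 < T) (x : ℝ) {t : ℝ}
    (ht : t ∈ Icc 0 T) :
    fderivWithin ℝ v (strip T) (x, t) (0, 1) ≤ (C - f (x, t)) * v (x, t) := by
  have hc : ∀ F : ℝ × ℝ → ℝ, ContinuousOn F (strip T) →
      ContinuousOn (fun s => F (x, s)) (closure (Ioo 0 T)) := fun F hF => by
    rw [closure_Ioo hT.ne]
    exact hF.comp (by fun_prop) fun s hs => ⟨mem_univ _, hs⟩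
  rw [← closure_Ioo hT.ne] at ht
  refine le_on_closure (f := fun s => fderivWithin ℝ v (strip T) (x, s) (0, 1))
    (g := fun s => (C - f (x, s)) * v (x, s)) (fun s hs => ?_)
    (hc (fun z => fderivWithin ℝ v (strip T) z (0, 1))
      ((h.contDiffOn_speed.continuousOn_fderivWithin (uniqueDiffOn_strip hT) (by simp)).clm_apply
        continuousOn_const))
    (hc (fun z => (C - f z) * v z)
      ((continuousOn_const.sub h.contDiffOn_curv.continuousOn).mul
        h.contDiffOn_speed.continuousOn)) ht
  simp only [fderivWithin_of_mem_nhds (strip_mem_nhds (x := x) hs)]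
  linarith [h.speed_le x s hs]

theorem continuousOn_length (h : IsEvolution T C A v f) (hT : 0 < T) :
    ContinuousOn (fun t => ∫ x in (0 : ℝ)..2 * Real.pi, v (x, t)) (Icc 0 T) :=
  continuousOn_integral_of_strip hT.le _ h.contDiffOn_speed.continuousOn

theorem continuousOn_totalCurvature (h : IsEvolution T C A v f) (hT : 0 < T) :
    ContinuousOn (fun t => ∫ x in (0 : ℝ)..2 * Real.pi, √(f (x, t)) * v (x, t)) (Icc 0 T) :=
  continuousOn_integral_of_strip (F := fun z => √(f z) * v z) hT.le _
    (h.contDiffOn_curv.continuousOn.sqrt.mul h.contDiffOn_speed.continuousOn)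

theorem length_deriv (h : IsEvolution T C A v f) (hT : 0 < T) {t : ℝ} (ht : t ∈ Icc 0 T) :
    ∃ d, HasDerivWithinAt (fun t => ∫ x in (0 : ℝ)..2 * Real.pi, v (x, t)) d (Icc 0 T) t ∧
      d ≤ ∫ x in (0 : ℝ)..2 * Real.pi, (C - f (x, t)) * v (x, t) := by
  refine ⟨_, hasDerivWithinAt_integral_of_strip hT h.contDiffOn_speed ht, ?_⟩
  refine intervalIntegral.integral_mono_on (by positivity) ?_ ?_
    fun x _ => h.speed_deriv_le hT x ht
  · exact (continuous_slice_of_strip (F := fun z => fderivWithin ℝ v (strip T) z (0, 1))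
      ((h.contDiffOn_speed.continuousOn_fderivWithin (uniqueDiffOn_strip hT) (by simp)).clm_apply
        continuousOn_const) ht).intervalIntegrable _ _
  · exact (continuous_slice_of_strip (F := fun z => (C - f z) * v z)
      ((continuousOn_const.sub h.contDiffOn_curv.continuousOn).mul
        h.contDiffOn_speed.continuousOn) ht).intervalIntegrable _ _

theorem length_deriv_le (h : IsEvolution T C A v f) (hT : 0 < T) {t : ℝ} (ht : t ∈ Icc 0 T) :
    ∃ d, HasDerivWithinAt (fun t => ∫ x in (0 : ℝ)..2 * Real.pi, v (x, t)) d (Icc 0 T) t ∧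
      d ≤ C * ∫ x in (0 : ℝ)..2 * Real.pi, v (x, t) := by
  obtain ⟨d, hd, hle⟩ := h.length_deriv hT ht
  refine ⟨d, hd, hle.trans ?_⟩
  rw [← intervalIntegral.integral_const_mul]
  refine intervalIntegral.integral_mono_on (by positivity) ?_ ?_ fun x _ => ?_
  · exact (continuous_slice_of_strip (F := fun z => (C - f z) * v z)
      ((continuousOn_const.sub h.contDiffOn_curv.continuousOn).mul
        h.contDiffOn_speed.continuousOn) ht).intervalIntegrable _ _
  · exact (continuous_slice_of_strip (F := fun z => C * v z)
      (continuousOn_const.mul h.contDiffOn_speed.continuousOn) ht).intervalIntegrable _ _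
  · have h1 := h.speed_pos (x, t) ⟨mem_univ _, ht⟩
    have h2 := h.curv_nonneg (x, t) ⟨mem_univ _, ht⟩
    nlinarith

theorem regTotalCurvature_deriv_le (h : IsEvolution T C A v f) (hT : 0 < T) (hA : 0 ≤ A)
    {ε : ℝ} (hε : 0 < ε) {t : ℝ} (ht : t ∈ Ioo 0 T) :
    ∃ d, HasDerivAt (fun t => ∫ x in (0 : ℝ)..2 * Real.pi, √(f (x, t) + ε ^ 2) * v (x, t)) d t ∧
      d ≤ (A + C) * (∫ x in (0 : ℝ)..2 * Real.pi, √(f (x, t) + ε ^ 2) * v (x, t)) +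
        A * ∫ x in (0 : ℝ)..2 * Real.pi, v (x, t) := by
  have htI := Ioo_subset_Icc_self ht
  have hsm : ContDiffOn ℝ ∞ (fun z => √(f z + ε ^ 2) * v z) (strip T) :=
    (h.contDiffOn_reg hε).mul h.contDiffOn_speed
  refine ⟨_, (hasDerivWithinAt_integral_of_strip hT hsm htI).hasDerivAt
    (Icc_mem_nhds ht.1 ht.2), ?_⟩
  obtain ⟨W, hW, hWper, hle⟩ := h.reg_deriv_le hA hε ht
  have hWi : IntervalIntegrable (deriv W) MeasureTheory.volume 0 (2 * Real.pi) :=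
    (hW.continuous_deriv le_rfl).intervalIntegrable _ _
  have hvi : IntervalIntegrable (fun x => v (x, t)) MeasureTheory.volume 0 (2 * Real.pi) :=
    (continuous_slice_of_strip h.contDiffOn_speed.continuousOn htI).intervalIntegrable _ _
  have hri : IntervalIntegrable (fun x => √(f (x, t) + ε ^ 2) * v (x, t)) MeasureTheory.volume
      0 (2 * Real.pi) :=
    (continuous_slice_of_strip hsm.continuousOn htI).intervalIntegrable _ _
  have hW0 : ∫ x in (0 : ℝ)..2 * Real.pi, deriv W x = 0 := by
    rw [intervalIntegral.integral_deriv_eq_sub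
      (fun x _ => (hW.differentiable one_ne_zero).differentiableAt) hWi, hWper, sub_self]
  calc _ ≤ ∫ x in (0 : ℝ)..2 * Real.pi, (deriv W x +
        ((A + C) * (√(f (x, t) + ε ^ 2) * v (x, t)) + A * v (x, t))) := by
        refine intervalIntegral.integral_mono_on (by positivity) ?_ ?_ fun x _ => ?_
        · exact (continuous_slice_of_strip
            (F := fun z => fderivWithin ℝ (fun z => √(f z + ε ^ 2) * v z) (strip T) z (0, 1))
            ((hsm.continuousOn_fderivWithin (uniqueDiffOn_strip hT) (by simp)).clm_apply
              continuousOn_const) htI).intervalIntegrable _ _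
        · exact hWi.add ((hri.const_mul _).add (hvi.const_mul _))
        · rw [fderivWithin_of_mem_nhds (strip_mem_nhds ht)]
          exact hle x
    _ = _ := by
        rw [intervalIntegral.integral_add hWi ((hri.const_mul _).add (hvi.const_mul _)), hW0,
          intervalIntegral.integral_add (hri.const_mul _) (hvi.const_mul _), zero_add,
          intervalIntegral.integral_const_mul, intervalIntegral.integral_const_mul]

theorem totalCurvature_le_reg (h : IsEvolution T C A v f) {ε : ℝ} (hε : 0 < ε) {t : ℝ}
    (ht : t ∈ Icc 0 T) :
    ∫ x in (0 : ℝ)..2 * Real.pi, √(f (x, t)) * v (x, t) ≤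
      ∫ x in (0 : ℝ)..2 * Real.pi, √(f (x, t) + ε ^ 2) * v (x, t) := by
  refine intervalIntegral.integral_mono_on (by positivity) ?_ ?_ fun x _ => ?_
  · exact (continuous_slice_of_strip (F := fun z => √(f z) * v z)
      (h.contDiffOn_curv.continuousOn.sqrt.mul h.contDiffOn_speed.continuousOn)
        ht).intervalIntegrable _ _
  · exact (continuous_slice_of_strip (F := fun z => √(f z + ε ^ 2) * v z)
      ((h.contDiffOn_reg hε).mul h.contDiffOn_speed).continuousOn ht).intervalIntegrable _ _
  · have h1 := h.speed_pos (x, t) ⟨mem_univ _, ht⟩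
    gcongr
    nlinarith

/-- From `√(f + ε²) ≤ √f + ε`. With `totalCurvature_le_reg` it confines the regularization error to
`[0, ε L]`. -/
theorem reg_le_totalCurvature (h : IsEvolution T C A v f) {ε : ℝ} (hε : 0 < ε) {t : ℝ}
    (ht : t ∈ Icc 0 T) :
    ∫ x in (0 : ℝ)..2 * Real.pi, √(f (x, t) + ε ^ 2) * v (x, t) ≤
      (∫ x in (0 : ℝ)..2 * Real.pi, √(f (x, t)) * v (x, t)) +
        ε * ∫ x in (0 : ℝ)..2 * Real.pi, v (x, t) := by
  have hvi : IntervalIntegrable (fun x => v (x, t)) MeasureTheory.volume 0 (2 * Real.pi) :=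
    (continuous_slice_of_strip h.contDiffOn_speed.continuousOn ht).intervalIntegrable _ _
  have hki := (continuous_slice_of_strip (F := fun z => √(f z) * v z)
      (h.contDiffOn_curv.continuousOn.sqrt.mul h.contDiffOn_speed.continuousOn)
        ht).intervalIntegrable (μ := MeasureTheory.volume) 0 (2 * Real.pi)
  rw [← intervalIntegral.integral_const_mul,
    ← intervalIntegral.integral_add hki (hvi.const_mul _)]
  refine intervalIntegral.integral_mono_on (by positivity) ?_ (hki.add (hvi.const_mul _))
    fun x _ => ?_
  · exact (continuous_slice_of_strip (F := fun z => √(f z + ε ^ 2) * v z)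
      ((h.contDiffOn_reg hε).mul h.contDiffOn_speed).continuousOn ht).intervalIntegrable _ _
  · have h1 := h.speed_pos (x, t) ⟨mem_univ _, ht⟩
    have h2 := h.curv_nonneg (x, t) ⟨mem_univ _, ht⟩
    have h3 : √(f (x, t) + ε ^ 2) ≤ √(f (x, t)) + ε := by
      refine Real.sqrt_le_iff.2 ⟨by positivity, ?_⟩
      nlinarith [Real.sq_sqrt h2, Real.sqrt_nonneg (f (x, t))]
    calc _ ≤ (√(f (x, t)) + ε) * v (x, t) := by gcongr
      _ = _ := by ring

/-- Mean value inequality for the total curvature, through its regularizations. -/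
theorem totalCurvature_sub_le (h : IsEvolution T C A v f) (hT : 0 < T) (hA : 0 ≤ A) (hC : 0 ≤ C)
    {a b r : ℝ} (hab : a ≤ b) (hsub : Icc a b ⊆ Icc 0 T)
    (hr : ∀ t ∈ Icc a b, (A + C) * (∫ x in (0 : ℝ)..2 * Real.pi, √(f (x, t)) * v (x, t)) +
      A * (∫ x in (0 : ℝ)..2 * Real.pi, v (x, t)) ≤ r) :
    (∫ x in (0 : ℝ)..2 * Real.pi, √(f (x, b)) * v (x, b)) -
      (∫ x in (0 : ℝ)..2 * Real.pi, √(f (x, a)) * v (x, a)) ≤ r * (b - a) := by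
  -- A bound of the length over all times makes the regularization error at most `ε m`, uniformly in
  -- time.
  obtain ⟨m, hm⟩ := (isCompact_Icc (a := (0 : ℝ)) (b := T)).exists_bound_of_continuousOn
    (h.continuousOn_length hT)
  have key : ∀ ε > 0, (∫ x in (0 : ℝ)..2 * Real.pi, √(f (x, b)) * v (x, b)) -
      (∫ x in (0 : ℝ)..2 * Real.pi, √(f (x, a)) * v (x, a)) ≤
        (r + (A + C) * (ε * m)) * (b - a) + ε * m := by
    intro ε hε
    have hm' : ∀ t ∈ Icc 0 T, ε * (∫ x in (0 : ℝ)..2 * Real.pi, v (x, t)) ≤ ε * m := fun t ht =>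
      mul_le_mul_of_nonneg_left ((le_abs_self _).trans (hm t ht)) hε.le
    have hd : ∀ t ∈ Ioo a b, t ∈ Ioo 0 T := fun t ht =>
      ⟨(hsub ⟨le_rfl, hab⟩).1.trans_lt ht.1, ht.2.trans_le (hsub ⟨hab, le_rfl⟩).2⟩
    have hmv := (convex_Icc a b).image_sub_le_mul_sub_of_deriv_le
      (f := fun t => ∫ x in (0 : ℝ)..2 * Real.pi, √(f (x, t) + ε ^ 2) * v (x, t))
      ((continuousOn_integral_of_strip (F := fun z => √(f z + ε ^ 2) * v z) hT.le _
        ((h.contDiffOn_reg hε).mul h.contDiffOn_speed).continuousOn).mono hsub)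
      (C := r + (A + C) * (ε * m))
      (by
        intro t ht
        rw [interior_Icc] at ht
        obtain ⟨d, hd, -⟩ := h.regTotalCurvature_deriv_le hT hA hε (hd t ht)
        exact hd.differentiableAt.differentiableWithinAt)
      (by
        intro t ht
        rw [interior_Icc] at ht
        obtain ⟨d, hd', hle⟩ := h.regTotalCurvature_deriv_le hT hA hε (hd t ht)
        rw [hd'.deriv]
        have htI := Ioo_subset_Icc_self (hd t ht)
        have h1 := (h.reg_le_totalCurvature hε htI).trans (add_le_add_right (hm' t htI) _)
        have h2 := hr t (Ioo_subset_Icc_self ht)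
        have h3 := mul_le_mul_of_nonneg_left h1 (add_nonneg hA hC)
        linarith)
      a ⟨le_rfl, hab⟩ b ⟨hab, le_rfl⟩ hab
    have hb := h.totalCurvature_le_reg hε (hsub ⟨hab, le_rfl⟩)
    have ha := (h.reg_le_totalCurvature hε (hsub ⟨le_rfl, hab⟩)).trans
      (add_le_add_right (hm' a (hsub ⟨le_rfl, hab⟩)) _)
    linarith
  have hlim : Tendsto (fun ε : ℝ => (r + (A + C) * (ε * m)) * (b - a) + ε * m) (𝓝[>] 0)
      (𝓝 (r * (b - a))) := by
    have : Continuous fun ε : ℝ => (r + (A + C) * (ε * m)) * (b - a) + ε * m := by fun_prop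
    simpa using (this.tendsto 0).mono_left nhdsWithin_le_nhds
  exact ge_of_tendsto hlim (eventually_mem_nhdsWithin.mono key)

/-- By continuity the right side stays below some `r < r'` near `t`, so the mean value inequality
with rate `r` holds on every short interval that ends or begins at `t`. This covers both one-sided
limits. -/
theorem totalCurvature_derivLE (h : IsEvolution T C A v f) (hT : 0 < T) (hA : 0 ≤ A) (hC : 0 ≤ C)
    {t : ℝ} (ht : t ∈ Icc 0 T) :
    DerivLEWithin (fun t => ∫ x in (0 : ℝ)..2 * Real.pi, √(f (x, t)) * v (x, t))
      ((A + C) * (∫ x in (0 : ℝ)..2 * Real.pi, √(f (x, t)) * v (x, t)) +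
        A * ∫ x in (0 : ℝ)..2 * Real.pi, v (x, t)) (Icc 0 T) t := by
  intro r' hr'
  obtain ⟨r, hr, hrr'⟩ := exists_between hr'
  have hcont := (((h.continuousOn_totalCurvature hT).const_mul (A + C)).add
    ((h.continuousOn_length hT).const_mul A)) t ht
  have hev := hcont.eventually_lt_const hr
  rw [eventually_nhdsWithin_iff, _root_.Metric.eventually_nhds_iff_ball] at hev
  obtain ⟨δ, hδ, hball⟩ := hev
  have hconv : Convex ℝ (_root_.Metric.ball t δ ∩ Icc 0 T) := (convex_ball t δ).inter (convex_Icc 0 T)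
  have key : ∀ a ∈ _root_.Metric.ball t δ ∩ Icc 0 T, ∀ b ∈ _root_.Metric.ball t δ ∩ Icc 0 T, a ≤ b →
      (∫ x in (0 : ℝ)..2 * Real.pi, √(f (x, b)) * v (x, b)) -
      (∫ x in (0 : ℝ)..2 * Real.pi, √(f (x, a)) * v (x, a)) ≤ r * (b - a) := by
    intro a ha b hb hab
    have hs : Icc a b ⊆ _root_.Metric.ball t δ ∩ Icc 0 T := hconv.ordConnected.out ha hb
    exact h.totalCurvature_sub_le hT hA hC hab (hs.trans inter_subset_right)
      fun τ hτ => (hball τ (hs hτ).1 (hs hτ).2).le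
  rw [eventually_nhdsWithin_iff, _root_.Metric.eventually_nhds_iff_ball]
  refine ⟨δ, hδ, fun s hs hs' => lt_of_le_of_lt ?_ hrr'⟩
  have htm : t ∈ _root_.Metric.ball t δ ∩ Icc 0 T := ⟨_root_.Metric.mem_ball_self hδ, ht⟩
  rcases lt_or_gt_of_ne (show s ≠ t from hs'.2) with hlt | hgt
  · rw [slope_comm, slope_def_field, div_le_iff₀ (sub_pos.2 hlt)]
    exact key s ⟨hs, hs'.1⟩ t htm hlt.le
  · rw [slope_def_field, div_le_iff₀ (sub_pos.2 hgt)]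
    exact key t htm s ⟨hs, hs'.1⟩ hgt.le

theorem length_le (h : IsEvolution T C A v f) (hT : 0 < T) {t : ℝ} (ht : t ∈ Icc 0 T) :
    ∫ x in (0 : ℝ)..2 * Real.pi, v (x, t) ≤
      (∫ x in (0 : ℝ)..2 * Real.pi, v (x, 0)) * Real.exp (C * t) := by
  have := le_gronwallBound_of_liminf_deriv_right_le (K := C) (ε := 0)
    (δ := ∫ x in (0 : ℝ)..2 * Real.pi, v (x, 0))
    (f' := fun t => C * ∫ x in (0 : ℝ)..2 * Real.pi, v (x, t))
    (h.continuousOn_length hT) (fun s hs r hr => ?_) le_rfl (fun s _ => by simp) t ht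
  · simpa [gronwallBound_ε0] using this
  · obtain ⟨d, hd, hle⟩ := h.length_deriv_le hT (Ico_subset_Icc_self hs)
    have hd' : HasDerivWithinAt (fun t => ∫ x in (0 : ℝ)..2 * Real.pi, v (x, t)) d (Ioi s) s :=
      (hd.mono_of_mem_nhdsWithin (Icc_mem_nhdsGT_of_mem hs))
    have := (hasDerivWithinAt_iff_tendsto_slope' self_notMem_Ioi).1 hd'
    refine ((this.eventually_lt_const (hle.trans_lt hr)).mono fun z hz => ?_).frequently
    simpa [slope_def_field, div_eq_inv_mul] using hz

/-- The sum closes under Gronwall: `(A + C) Θ + A L` and `C L` add up to `(A + C)(Θ + L)`. -/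
theorem totalCurvature_add_length_le (h : IsEvolution T C A v f) (hT : 0 < T) (hA : 0 ≤ A)
    (hC : 0 ≤ C) {t : ℝ} (ht : t ∈ Icc 0 T) :
    (∫ x in (0 : ℝ)..2 * Real.pi, √(f (x, t)) * v (x, t)) +
        (∫ x in (0 : ℝ)..2 * Real.pi, v (x, t)) ≤
      ((∫ x in (0 : ℝ)..2 * Real.pi, √(f (x, 0)) * v (x, 0)) +
        ∫ x in (0 : ℝ)..2 * Real.pi, v (x, 0)) * Real.exp ((A + C) * t) := by
  have := le_gronwallBound_of_liminf_deriv_right_le (K := A + C) (ε := 0)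
    (δ := (∫ x in (0 : ℝ)..2 * Real.pi, √(f (x, 0)) * v (x, 0)) +
        ∫ x in (0 : ℝ)..2 * Real.pi, v (x, 0))
    (f' := fun t => (A + C) * ((∫ x in (0 : ℝ)..2 * Real.pi, √(f (x, t)) * v (x, t)) +
        ∫ x in (0 : ℝ)..2 * Real.pi, v (x, t)))
    ((h.continuousOn_totalCurvature hT).add (h.continuousOn_length hT))
    (fun s hs r hr => ?_) le_rfl (fun s _ => by simp) t ht
  · simpa [gronwallBound_ε0] using this
  · obtain ⟨d, hd, hle⟩ := h.length_deriv_le hT (Ico_subset_Icc_self hs)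
    have hd' : HasDerivWithinAt (fun t => ∫ x in (0 : ℝ)..2 * Real.pi, v (x, t)) d (Ioi s) s :=
      (hd.mono_of_mem_nhdsWithin (Icc_mem_nhdsGT_of_mem hs))
    have hd'' := (hasDerivWithinAt_iff_tendsto_slope' self_notMem_Ioi).1 hd'
    set θ := fun t => ∫ x in (0 : ℝ)..2 * Real.pi, √(f (x, t)) * v (x, t) with hθ
    set l := fun t => ∫ x in (0 : ℝ)..2 * Real.pi, v (x, t) with hl
    -- The slack below `r` is shared: one `η` for the slope of `Θ`, one for the slope of `L`.
    obtain ⟨η, hη, hηr⟩ : ∃ η > 0, (A + C) * (θ s + l s) + 2 * η < r :=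
      ⟨(r - (A + C) * (θ s + l s)) / 4, by simp only [hθ, hl] at hr ⊢; linarith,
        by simp only [hθ, hl] at hr ⊢; linarith⟩
    have h1 := hd''.eventually_lt_const (show d < C * l s + η by simp only [hl]; linarith)
    have h2 := h.totalCurvature_derivLE hT hA hC (Ico_subset_Icc_self hs)
      ((A + C) * θ s + A * l s + η) (by simp only [hθ, hl]; linarith)
    -- Gronwall asks for slopes to the right only, which the two-sided bound contains.
    have h3 : 𝓝[>] s ≤ 𝓝[Icc 0 T \ {s}] s := by
      refine nhdsWithin_le_of_mem (Filter.inter_mem (Icc_mem_nhdsGT_of_mem hs) ?_)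
      exact mem_of_superset self_mem_nhdsWithin fun y hy => (ne_of_gt hy : y ≠ s)
    refine ((h1.and (h2.filter_mono h3)).mono fun z hz => ?_).frequently
    obtain ⟨hz1, hz2⟩ := hz
    rw [slope_def_field, div_eq_inv_mul] at hz1 hz2
    calc (z - s)⁻¹ * (θ z + l z - (θ s + l s)) =
        (z - s)⁻¹ * (θ z - θ s) + (z - s)⁻¹ * (l z - l s) := by ring
      _ < ((A + C) * θ s + A * l s + η) + (C * l s + η) := add_lt_add hz2 hz1
      _ ≤ r := by linarith

end IsEvolution

/-! ### Covariant derivatives along a moving curve. -/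

section Connection

variable {E : Type*} [NormedAddCommGroup E] [NormedSpace ℝ E]

/-- The second derivatives of a smooth map on space-time commute. -/
theorem fderiv_fderiv_comm {V : ℝ × ℝ → E} {z : ℝ × ℝ} (hV : ContDiffAt ℝ ∞ V z) (a b : ℝ × ℝ) :
    fderiv ℝ (fun w => fderiv ℝ V w b) z a = fderiv ℝ (fun w => fderiv ℝ V w a) z b := by
  have hd : DifferentiableAt ℝ (fderiv ℝ V) z :=
    (hV.fderiv_right (m := ∞) (by simp)).differentiableAt (by simp)
  have h := hV.isSymmSndFDerivAt (n := ∞)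
    (by rw [minSmoothness_of_isRCLikeNormedField]; exact WithTop.coe_le_coe.2 le_top)
  have e : ∀ c d : ℝ × ℝ, fderiv ℝ (fun w => fderiv ℝ V w c) z d = fderiv ℝ (fderiv ℝ V) z d c :=
    fun c d => by
      rw [fderiv_clm_apply hd (differentiableAt_const c)]
      simp
  rw [e, e]
  exact h a b

/-- The covariant derivative in the direction `a` of space-time of a vector field `V` along the
moving curve `γ`, for the time-dependent connection `Γ`. -/
def covD (Γ : E × ℝ → E →L[ℝ] E →L[ℝ] E) (γ : ℝ × ℝ → E) (a : ℝ × ℝ) (V : ℝ × ℝ → E)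
    (z : ℝ × ℝ) : E :=
  fderiv ℝ V z a + Γ (γ z, z.2) (fderiv ℝ γ z a) (V z)

variable {G : E × ℝ → E →L[ℝ] E →L[ℝ] ℝ} {Γ : E × ℝ → E →L[ℝ] E →L[ℝ] E} {γ : ℝ × ℝ → E}
  {z : ℝ × ℝ}

theorem hasFDerivAt_lift (hγ : DifferentiableAt ℝ γ z) :
    HasFDerivAt (fun w : ℝ × ℝ => (γ w, w.2))
      ((fderiv ℝ γ z).prod (ContinuousLinearMap.snd ℝ ℝ ℝ)) z :=
  hγ.hasFDerivAt.prodMk hasFDerivAt_snd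

theorem hasFDerivAt_comp_lift {F : Type*} [NormedAddCommGroup F] [NormedSpace ℝ F] {K : E × ℝ → F}
    (hγ : DifferentiableAt ℝ γ z) (hK : DifferentiableAt ℝ K (γ z, z.2)) :
    HasFDerivAt (fun w : ℝ × ℝ => K (γ w, w.2)) ((fderiv ℝ K (γ z, z.2)).comp
      ((fderiv ℝ γ z).prod (ContinuousLinearMap.snd ℝ ℝ ℝ))) z :=
  HasFDerivAt.comp (g := K) (f := fun w : ℝ × ℝ => (γ w, w.2)) z hK.hasFDerivAt
    (hasFDerivAt_lift hγ)

/-- The Cauchy-Schwarz inequality for a positive definite symmetric form. -/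
theorem sq_le_of_posDef {g : E →L[ℝ] E →L[ℝ] ℝ} (hs : ∀ u w, g u w = g w u)
    (hp : ∀ u, u ≠ 0 → 0 < g u u) (u w : E) : g u w ^ 2 ≤ g u u * g w w := by
  rcases eq_or_ne w 0 with rfl | hw
  · simp
  have hw' := hp w hw
  have h : 0 ≤ g (g w w • u - g u w • w) (g w w • u - g u w • w) := by
    rcases eq_or_ne (g w w • u - g u w • w) 0 with h0 | h0
    · rw [h0]; simp
    · exact (hp _ h0).le
  have e : g (g w w • u - g u w • w) (g w w • u - g u w • w) =
      g w w * (g u u * g w w - g u w ^ 2) := by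
    simp only [map_sub, map_smul, _root_.sub_apply, _root_.smul_apply, smul_eq_mul, hs w u]
    ring
  rw [e] at h
  linarith [nonneg_of_mul_nonneg_right h hw']

/-- The connection preserves the metric at each fixed time. Hence the product rule has one extra
term, the time derivative of the metric, weighted by the time component of the direction. -/
theorem fderiv_metric (hγ : DifferentiableAt ℝ γ z) (hG : DifferentiableAt ℝ G (γ z, z.2))
    (hc : ∀ u v w, fderiv ℝ G (γ z, z.2) (u, 0) v w =
      G (γ z, z.2) (Γ (γ z, z.2) u v) w + G (γ z, z.2) v (Γ (γ z, z.2) u w))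
    {V W : ℝ × ℝ → E} (hV : DifferentiableAt ℝ V z) (hW : DifferentiableAt ℝ W z) (a : ℝ × ℝ) :
    fderiv ℝ (fun w => G (γ w, w.2) (V w) (W w)) z a =
      a.2 * fderiv ℝ G (γ z, z.2) (0, 1) (V z) (W z) + G (γ z, z.2) (covD Γ γ a V z) (W z)
        + G (γ z, z.2) (V z) (covD Γ γ a W z) := by
  have h0 := hasFDerivAt_comp_lift (K := G) hγ hG
  have h1 := h0.clm_apply hV.hasFDerivAt
  have h := h1.clm_apply hW.hasFDerivAt
  have e : ((fderiv ℝ γ z a, a.2) : E × ℝ) = (fderiv ℝ γ z a, 0) + a.2 • ((0 : E), (1 : ℝ)) := by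
    simp
  have h' := congrArg (fun L : ℝ × ℝ →L[ℝ] ℝ => L a) h.fderiv
  refine h'.trans ?_
  simp only [_root_.add_apply, ContinuousLinearMap.comp_apply,
    ContinuousLinearMap.flip_apply, ContinuousLinearMap.prod_apply,
    ContinuousLinearMap.coe_snd', e, map_add, map_smul, hc, covD,
    _root_.smul_apply, smul_eq_mul]
  ring

/-- The connection has no torsion. -/
theorem covD_fderiv_comm (hγ : ContDiffAt ℝ ∞ γ z)
    (hs : ∀ u v, Γ (γ z, z.2) u v = Γ (γ z, z.2) v u) (a b : ℝ × ℝ) :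
    covD Γ γ a (fun w => fderiv ℝ γ w b) z = covD Γ γ b (fun w => fderiv ℝ γ w a) z := by
  simp only [covD, fderiv_fderiv_comm hγ a b, hs (fderiv ℝ γ z a)]

theorem covD_smul {p : ℝ × ℝ → ℝ} {V : ℝ × ℝ → E} (hp : DifferentiableAt ℝ p z)
    (hV : DifferentiableAt ℝ V z) (a : ℝ × ℝ) :
    covD Γ γ a (fun w => p w • V w) z = fderiv ℝ p z a • V z + p z • covD Γ γ a V z := by
  simp only [covD, fderiv_fun_smul hp hV, _root_.add_apply,
    _root_.smul_apply, ContinuousLinearMap.smulRight_apply, map_smul, smul_add]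
  abel

theorem covD_add {V W : ℝ × ℝ → E} (hV : DifferentiableAt ℝ V z) (hW : DifferentiableAt ℝ W z)
    (a : ℝ × ℝ) :
    covD Γ γ a (fun w => V w + W w) z = covD Γ γ a V z + covD Γ γ a W z := by
  simp only [covD, fderiv_fun_add hV hW, _root_.add_apply, map_add]
  abel

theorem covD_congr {V W : ℝ × ℝ → E} (h : V =ᶠ[𝓝 z] W) (a : ℝ × ℝ) :
    covD Γ γ a V z = covD Γ γ a W z := by
  simp only [covD, h.fderiv_eq, h.eq_of_nhds]

/-- The curvature of the connection `Γ` along the moving curve. -/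
def curvOp (Γ : E × ℝ → E →L[ℝ] E →L[ℝ] E) (γ : ℝ × ℝ → E) (a b : ℝ × ℝ) (z : ℝ × ℝ) (V : E) :
    E :=
  fderiv ℝ Γ (γ z, z.2) (fderiv ℝ γ z a, a.2) (fderiv ℝ γ z b) V
    - fderiv ℝ Γ (γ z, z.2) (fderiv ℝ γ z b, b.2) (fderiv ℝ γ z a) V
    + Γ (γ z, z.2) (fderiv ℝ γ z a) (Γ (γ z, z.2) (fderiv ℝ γ z b) V)
    - Γ (γ z, z.2) (fderiv ℝ γ z b) (Γ (γ z, z.2) (fderiv ℝ γ z a) V)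

/-- Second partial derivatives of `V` and `γ` cancel in the commutator. Since `Γ` depends on time,
`curvOp` contains its time derivative besides the curvature tensor. -/
theorem covD_covD (hγ : ContDiffAt ℝ ∞ γ z) (hΓ : DifferentiableAt ℝ Γ (γ z, z.2))
    {V : ℝ × ℝ → E} (hV : ContDiffAt ℝ ∞ V z) (a b : ℝ × ℝ) :
    covD Γ γ a (covD Γ γ b V) z = covD Γ γ b (covD Γ γ a V) z + curvOp Γ γ a b z (V z) := by
  have hγd : DifferentiableAt ℝ γ z := hγ.differentiableAt (by simp)
  have hVd : DifferentiableAt ℝ V z := hV.differentiableAt (by simp)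
  have hdd : ∀ {F : ℝ × ℝ → E}, ContDiffAt ℝ ∞ F z → ∀ c,
      DifferentiableAt ℝ (fun w => fderiv ℝ F w c) z := fun hF c =>
    ((hF.fderiv_right (m := ∞) (by simp)).differentiableAt (by simp)).clm_apply
      (differentiableAt_const c)
  have key : ∀ c d, fderiv ℝ (covD Γ γ d V) z c =
      fderiv ℝ (fun w => fderiv ℝ V w d) z c +
      (fderiv ℝ Γ (γ z, z.2) (fderiv ℝ γ z c, c.2) (fderiv ℝ γ z d) (V z) +
        Γ (γ z, z.2) (fderiv ℝ (fun w => fderiv ℝ γ w d) z c) (V z) +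
        Γ (γ z, z.2) (fderiv ℝ γ z d) (fderiv ℝ V z c)) := by
    intro c d
    have h := (hdd hV d).hasFDerivAt.add
      (((hasFDerivAt_comp_lift hγd hΓ).clm_apply (hdd hγ d).hasFDerivAt).clm_apply hVd.hasFDerivAt)
    have h' := congrArg (fun L : ℝ × ℝ →L[ℝ] E => L c) h.fderiv
    refine h'.trans ?_
    simp only [_root_.add_apply, ContinuousLinearMap.comp_apply,
      ContinuousLinearMap.flip_apply, ContinuousLinearMap.prod_apply,
      ContinuousLinearMap.coe_snd']
    abel
  have hb : ∀ c d, covD Γ γ c (covD Γ γ d V) z = fderiv ℝ (covD Γ γ d V) z c +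
      Γ (γ z, z.2) (fderiv ℝ γ z c) (covD Γ γ d V z) := fun _ _ => rfl
  rw [hb a b, hb b a, key a b, key b a, fderiv_fderiv_comm hV a b, fderiv_fderiv_comm hγ a b]
  simp only [curvOp, covD, map_add]
  abel

theorem contDiffOn_fderiv_apply {W : Set (ℝ × ℝ)} (hW : IsOpen W) {V : ℝ × ℝ → E}
    (hV : ContDiffOn ℝ ∞ V W) (a : ℝ × ℝ) : ContDiffOn ℝ ∞ (fun w => fderiv ℝ V w a) W :=
  (hV.fderiv_of_isOpen hW (m := ∞) (by simp)).clm_apply contDiffOn_const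

theorem contDiffOn_covD {W : Set (ℝ × ℝ)} (hW : IsOpen W) (hγ : ContDiffOn ℝ ∞ γ W)
    (hΓ : ∀ z ∈ W, ContDiffAt ℝ ∞ Γ (γ z, z.2)) {V : ℝ × ℝ → E} (hV : ContDiffOn ℝ ∞ V W)
    (a : ℝ × ℝ) : ContDiffOn ℝ ∞ (covD Γ γ a V) W := by
  have h1 : ContDiffOn ℝ ∞ (fun w => Γ (γ w, w.2)) W := fun w hw =>
    (hΓ w hw).comp_contDiffWithinAt (f := fun w => (γ w, w.2)) w
      ((hγ w hw).prodMk contDiffWithinAt_snd)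
  exact (contDiffOn_fderiv_apply hW hV a).add
    ((h1.clm_apply (contDiffOn_fderiv_apply hW hγ a)).clm_apply hV)

/-- The unit tangent field `v⁻¹ • ∂γ/∂x` of a moving curve `γ` with speed `v`. -/
def unitField (v : ℝ × ℝ → ℝ) (γ : ℝ × ℝ → E) (z : ℝ × ℝ) : E := (v z)⁻¹ • dx γ z

/-! ### Evolution equations of a curve-shrinking flow in one chart. -/

/-- A curve-shrinking flow in a coordinate domain, on an open set `W` of space-time, for a
time-dependent metric `G` with connection `Γ`. -/
structure IsLocalFlow (W : Set (ℝ × ℝ)) (G : E × ℝ → E →L[ℝ] E →L[ℝ] ℝ)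
    (Γ : E × ℝ → E →L[ℝ] E →L[ℝ] E) (γ : ℝ × ℝ → E) (v : ℝ × ℝ → ℝ) : Prop where
  isOpen : IsOpen W
  contDiffOn : ContDiffOn ℝ ∞ γ W
  contDiffAt_metric : ∀ z ∈ W, ContDiffAt ℝ ∞ G (γ z, z.2)
  contDiffAt_conn : ∀ z ∈ W, ContDiffAt ℝ ∞ Γ (γ z, z.2)
  symm : ∀ z ∈ W, ∀ u w, G (γ z, z.2) u w = G (γ z, z.2) w u
  pos : ∀ z ∈ W, ∀ u, u ≠ 0 → 0 < G (γ z, z.2) u u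
  conn_symm : ∀ z ∈ W, ∀ u w, Γ (γ z, z.2) u w = Γ (γ z, z.2) w u
  compat : ∀ z ∈ W, ∀ u v w, fderiv ℝ G (γ z, z.2) (u, 0) v w =
      G (γ z, z.2) (Γ (γ z, z.2) u v) w + G (γ z, z.2) v (Γ (γ z, z.2) u w)
  immersed : ∀ z ∈ W, dx γ z ≠ 0
  speed_eq : ∀ z ∈ W, v z = √(G (γ z, z.2) (dx γ z) (dx γ z))
  evolution : ∀ z ∈ W, dt γ z = (v z)⁻¹ • covD Γ γ (1, 0) (unitField v γ) z

namespace IsLocalFlow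

variable {W : Set (ℝ × ℝ)} {v : ℝ × ℝ → ℝ}

theorem contDiffOn_metric_apply (h : IsLocalFlow W G Γ γ v) {U V : ℝ × ℝ → E}
    (hU : ContDiffOn ℝ ∞ U W) (hV : ContDiffOn ℝ ∞ V W) :
    ContDiffOn ℝ ∞ (fun w => G (γ w, w.2) (U w) (V w)) W := by
  have h1 : ContDiffOn ℝ ∞ (fun w => G (γ w, w.2)) W := fun w hw =>
    (h.contDiffAt_metric w hw).comp_contDiffWithinAt (f := fun w => (γ w, w.2)) w
      ((h.contDiffOn w hw).prodMk contDiffWithinAt_snd)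
  exact (h1.clm_apply hU).clm_apply hV

theorem differentiableAt (h : IsLocalFlow W G Γ γ v) {F : Type*} [NormedAddCommGroup F]
    [NormedSpace ℝ F] {V : ℝ × ℝ → F} (hV : ContDiffOn ℝ ∞ V W) (hz : z ∈ W) :
    DifferentiableAt ℝ V z :=
  (hV.contDiffAt (h.isOpen.mem_nhds hz)).differentiableAt (by simp)

theorem fderiv_inner (h : IsLocalFlow W G Γ γ v) (hz : z ∈ W) {U V : ℝ × ℝ → E}
    (hU : ContDiffOn ℝ ∞ U W) (hV : ContDiffOn ℝ ∞ V W) (a : ℝ × ℝ) :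
    fderiv ℝ (fun w => G (γ w, w.2) (U w) (V w)) z a =
      a.2 * fderiv ℝ G (γ z, z.2) (0, 1) (U z) (V z) + G (γ z, z.2) (covD Γ γ a U z) (V z)
        + G (γ z, z.2) (U z) (covD Γ γ a V z) :=
  fderiv_metric (h.differentiableAt h.contDiffOn hz)
    ((h.contDiffAt_metric z hz).differentiableAt (by simp)) (h.compat z hz)
    (h.differentiableAt hU hz) (h.differentiableAt hV hz) a

theorem dx_inner (h : IsLocalFlow W G Γ γ v) (hz : z ∈ W) {U V : ℝ × ℝ → E}
    (hU : ContDiffOn ℝ ∞ U W) (hV : ContDiffOn ℝ ∞ V W) :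
    dx (fun w => G (γ w, w.2) (U w) (V w)) z =
      G (γ z, z.2) (covD Γ γ (1, 0) U z) (V z) + G (γ z, z.2) (U z) (covD Γ γ (1, 0) V z) := by
  rw [dx, h.fderiv_inner hz hU hV, zero_mul, zero_add]

theorem dt_inner_self (h : IsLocalFlow W G Γ γ v) (hz : z ∈ W) {U : ℝ × ℝ → E}
    (hU : ContDiffOn ℝ ∞ U W) :
    dt (fun w => G (γ w, w.2) (U w) (U w)) z = fderiv ℝ G (γ z, z.2) (0, 1) (U z) (U z) +
      2 * G (γ z, z.2) (covD Γ γ (0, 1) U z) (U z) := by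
  rw [dt, h.fderiv_inner hz hU hU, one_mul, h.symm z hz (U z)]
  ring

theorem speed_pos (h : IsLocalFlow W G Γ γ v) (hz : z ∈ W) : 0 < v z := by
  rw [h.speed_eq z hz]
  exact Real.sqrt_pos.2 (h.pos z hz _ (h.immersed z hz))

theorem dx_eq (h : IsLocalFlow W G Γ γ v) (hz : z ∈ W) : dx γ z = v z • unitField v γ z := by
  rw [unitField, smul_inv_smul₀ (h.speed_pos hz).ne']

theorem speed_sq (h : IsLocalFlow W G Γ γ v) (hz : z ∈ W) :
    v z ^ 2 = G (γ z, z.2) (dx γ z) (dx γ z) := by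
  rw [h.speed_eq z hz, Real.sq_sqrt (h.pos z hz _ (h.immersed z hz)).le]

theorem contDiffOn_dx (h : IsLocalFlow W G Γ γ v) : ContDiffOn ℝ ∞ (dx γ) W :=
  contDiffOn_fderiv_apply h.isOpen h.contDiffOn _

theorem contDiffOn_dt (h : IsLocalFlow W G Γ γ v) : ContDiffOn ℝ ∞ (dt γ) W :=
  contDiffOn_fderiv_apply h.isOpen h.contDiffOn _

theorem contDiffOn_speed (h : IsLocalFlow W G Γ γ v) : ContDiffOn ℝ ∞ v W :=
  ((h.contDiffOn_metric_apply h.contDiffOn_dx h.contDiffOn_dx).sqrt fun z hz =>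
    (h.pos z hz _ (h.immersed z hz)).ne').congr h.speed_eq

theorem contDiffOn_speed_inv (h : IsLocalFlow W G Γ γ v) : ContDiffOn ℝ ∞ (fun z => (v z)⁻¹) W :=
  h.contDiffOn_speed.inv fun _ hz => (h.speed_pos hz).ne'

theorem contDiffOn_unitField (h : IsLocalFlow W G Γ γ v) : ContDiffOn ℝ ∞ (unitField v γ) W :=
  h.contDiffOn_speed_inv.smul h.contDiffOn_dx

theorem contDiffOn_covD (h : IsLocalFlow W G Γ γ v) {V : ℝ × ℝ → E} (hV : ContDiffOn ℝ ∞ V W)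
    (a : ℝ × ℝ) : ContDiffOn ℝ ∞ (covD Γ γ a V) W :=
  RicciCSF.contDiffOn_covD h.isOpen h.contDiffOn h.contDiffAt_conn hV a

theorem fderiv_speed_inv (h : IsLocalFlow W G Γ γ v) (hz : z ∈ W) (a : ℝ × ℝ) :
    fderiv ℝ (fun w => (v w)⁻¹) z a = -(fderiv ℝ v z a / v z ^ 2) := by
  have h1 : HasFDerivAt (fun w => (v w)⁻¹) (-(v z ^ 2)⁻¹ • fderiv ℝ v z) z :=
    (hasDerivAt_inv (h.speed_pos hz).ne').comp_hasFDerivAt z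
      (h.differentiableAt h.contDiffOn_speed hz).hasFDerivAt
  rw [h1.fderiv, _root_.smul_apply, smul_eq_mul]
  ring

theorem inner_unitField (h : IsLocalFlow W G Γ γ v) (hz : z ∈ W) :
    G (γ z, z.2) (unitField v γ z) (unitField v γ z) = 1 := by
  have h1 := h.speed_sq hz
  have hv := h.speed_pos hz
  rw [h.dx_eq hz] at h1
  simp only [map_smul, _root_.smul_apply, smul_eq_mul] at h1
  have : v z ^ 2 * (G (γ z, z.2) (unitField v γ z) (unitField v γ z)) = v z ^ 2 * 1 := by linarith
  exact mul_left_cancel₀ (by positivity) this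

/-- The flow equation in the form used below: `dt γ` stands for the curvature vector `H` from here
on. -/
theorem covD_unitField (h : IsLocalFlow W G Γ γ v) (hz : z ∈ W) :
    covD Γ γ (1, 0) (unitField v γ) z = v z • dt γ z := by
  rw [h.evolution z hz, smul_inv_smul₀ (h.speed_pos hz).ne']

/-- Differentiate `g(S, S) = 1` along the curve. -/
theorem inner_dt_unitField (h : IsLocalFlow W G Γ γ v) (hz : z ∈ W) :
    G (γ z, z.2) (dt γ z) (unitField v γ z) = 0 := by
  have h1 := h.dx_inner hz h.contDiffOn_unitField h.contDiffOn_unitField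
  have h2 : (fun w => G (γ w, w.2) (unitField v γ w) (unitField v γ w)) =ᶠ[𝓝 z] fun _ => 1 :=
    eventually_of_mem (h.isOpen.mem_nhds hz) fun w hw => h.inner_unitField hw
  rw [dx, h2.fderiv_eq, h.covD_unitField hz, h.symm z hz (unitField v γ z)] at h1
  simp only [fderiv_fun_const, Pi.zero_apply, _root_.zero_apply, map_smul, _root_.smul_apply,
    smul_eq_mul] at h1
  have : v z * (G (γ z, z.2) (dt γ z) (unitField v γ z)) = 0 := by linarith
  exact (mul_eq_zero.1 this).resolve_left (h.speed_pos hz).ne'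

/-- Differentiate `g(H, S) = 0` along the curve. -/
theorem inner_covD_dt_unitField (h : IsLocalFlow W G Γ γ v) (hz : z ∈ W) :
    G (γ z, z.2) (covD Γ γ (1, 0) (dt γ) z) (unitField v γ z) =
      -(v z * G (γ z, z.2) (dt γ z) (dt γ z)) := by
  have h1 := h.dx_inner hz h.contDiffOn_dt h.contDiffOn_unitField
  have h2 : (fun w => G (γ w, w.2) (dt γ w) (unitField v γ w)) =ᶠ[𝓝 z] fun _ => 0 :=
    eventually_of_mem (h.isOpen.mem_nhds hz) fun w hw => h.inner_dt_unitField hw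
  rw [dx, h2.fderiv_eq, h.covD_unitField hz] at h1
  simp only [fderiv_fun_const, Pi.zero_apply, _root_.zero_apply, map_smul, smul_eq_mul] at h1
  linarith

theorem covD_dx_eq (h : IsLocalFlow W G Γ γ v) (hz : z ∈ W) :
    covD Γ γ (0, 1) (dx γ) z = covD Γ γ (1, 0) (dt γ) z :=
  covD_fderiv_comm (h.contDiffOn.contDiffAt (h.isOpen.mem_nhds hz)) (h.conn_symm z hz) _ _

/-- Evolution of the speed. -/
theorem dt_speed (h : IsLocalFlow W G Γ γ v) (hz : z ∈ W) :
    dt v z = v z * (1 / 2 * fderiv ℝ G (γ z, z.2) (0, 1) (unitField v γ z) (unitField v γ z) -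
      G (γ z, z.2) (dt γ z) (dt γ z)) := by
  have hv := h.speed_pos hz
  have h1 := h.dt_inner_self hz h.contDiffOn_dx
  have h2 : (fun w => G (γ w, w.2) (dx γ w) (dx γ w)) =ᶠ[𝓝 z] fun w => v w ^ 2 :=
    eventually_of_mem (h.isOpen.mem_nhds hz) fun w hw => (h.speed_sq hw).symm
  have h3 := h.inner_covD_dt_unitField hz
  have h4 : dt (fun w => v w ^ 2) z = 2 * v z * dt v z := by
    rw [dt, fderiv_fun_pow 2 (h.differentiableAt h.contDiffOn_speed hz)]
    simp
  rw [dt, h2.fderiv_eq, h.covD_dx_eq hz, h.dx_eq hz] at h1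
  simp only [map_smul, _root_.smul_apply, smul_eq_mul, h3] at h1
  refine mul_left_cancel₀ hv.ne' ?_
  linear_combination (1 / 2) * h1 - (1 / 2) * h4

/-- Evolution of the unit tangent. -/
theorem covD_dt_unitField (h : IsLocalFlow W G Γ γ v) (hz : z ∈ W) :
    covD Γ γ (0, 1) (unitField v γ) z = (-(dt v z * (v z)⁻¹)) • unitField v γ z +
      (v z)⁻¹ • covD Γ γ (1, 0) (dt γ) z := by
  have := covD_smul (Γ := Γ) (γ := γ) (h.differentiableAt h.contDiffOn_speed_inv hz)
    (h.differentiableAt h.contDiffOn_dx hz) (0, 1)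
  refine this.trans ?_
  rw [h.covD_dx_eq hz, h.fderiv_speed_inv hz, unitField, smul_smul]
  congr 2
  field_simp

/-- The derivative `∇_S H` of the curvature vector along the curve. -/
def dsCurv (Γ : E × ℝ → E →L[ℝ] E →L[ℝ] E) (γ : ℝ × ℝ → E) (v : ℝ × ℝ → ℝ) (z : ℝ × ℝ) : E :=
  (v z)⁻¹ • covD Γ γ (1, 0) (dt γ) z

theorem contDiffOn_dsCurv (h : IsLocalFlow W G Γ γ v) : ContDiffOn ℝ ∞ (dsCurv Γ γ v) W :=
  h.contDiffOn_speed_inv.smul (h.contDiffOn_covD h.contDiffOn_dt _)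

theorem covD_dt_eq (h : IsLocalFlow W G Γ γ v) (hz : z ∈ W) :
    covD Γ γ (1, 0) (dt γ) z = v z • dsCurv Γ γ v z := by
  rw [dsCurv, smul_inv_smul₀ (h.speed_pos hz).ne']

theorem inner_dsCurv_unitField (h : IsLocalFlow W G Γ γ v) (hz : z ∈ W) :
    G (γ z, z.2) (dsCurv Γ γ v z) (unitField v γ z) = -G (γ z, z.2) (dt γ z) (dt γ z) := by
  have h1 := h.inner_covD_dt_unitField hz
  rw [h.covD_dt_eq hz, map_smul, _root_.smul_apply, smul_eq_mul] at h1
  exact mul_left_cancel₀ (h.speed_pos hz).ne' (by linarith)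

/-- Evolution of the curvature vector. -/
theorem covD_dt_dt (h : IsLocalFlow W G Γ γ v) (hz : z ∈ W) :
    covD Γ γ (0, 1) (dt γ) z = (2 * -(dt v z * (v z)⁻¹)) • dt γ z +
      (v z)⁻¹ • (fderiv ℝ (fun w => -(dt v w * (v w)⁻¹)) z (1, 0) • unitField v γ z +
        covD Γ γ (1, 0) (dsCurv Γ γ v) z + curvOp Γ γ (0, 1) (1, 0) z (unitField v γ z)) := by
  have hv := h.speed_pos hz
  have hnhds := h.isOpen.mem_nhds hz
  -- The factor `-v_t / v` is what the commutator of `∂_t` with `∂_s = v⁻¹ ∂_x` produces. It occurs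
  -- twice, from `v⁻¹` in `H = v⁻¹ ∇_X S` and from the evolution of `S`.
  have hμ : ContDiffOn ℝ ∞ (fun w => -(dt v w * (v w)⁻¹)) W :=
    ((contDiffOn_fderiv_apply h.isOpen h.contDiffOn_speed _).mul h.contDiffOn_speed_inv).neg
  have h1 : covD Γ γ (0, 1) (dt γ) z =
      covD Γ γ (0, 1) (fun w => (v w)⁻¹ • covD Γ γ (1, 0) (unitField v γ) w) z :=
    covD_congr (eventually_of_mem hnhds h.evolution) _
  have h2 : covD Γ γ (1, 0) (covD Γ γ (0, 1) (unitField v γ)) z = covD Γ γ (1, 0)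
      (fun w => (-(dt v w * (v w)⁻¹)) • unitField v γ w + dsCurv Γ γ v w) z :=
    covD_congr (eventually_of_mem hnhds fun w hw => h.covD_dt_unitField hw) _
  rw [h1, covD_smul (h.differentiableAt h.contDiffOn_speed_inv hz)
    (h.differentiableAt (h.contDiffOn_covD h.contDiffOn_unitField _) hz),
    covD_covD (h.contDiffOn.contDiffAt hnhds)
      ((h.contDiffAt_conn z hz).differentiableAt (by simp))
      (h.contDiffOn_unitField.contDiffAt hnhds), h2,
    covD_add (V := fun w => (-(dt v w * (v w)⁻¹)) • unitField v γ w)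
      (h.differentiableAt (hμ.smul h.contDiffOn_unitField) hz)
      (h.differentiableAt h.contDiffOn_dsCurv hz),
    covD_smul (h.differentiableAt hμ hz) (h.differentiableAt h.contDiffOn_unitField hz),
    h.covD_unitField hz, h.fderiv_speed_inv hz]
  simp only [smul_add, smul_smul]
  have e1 : -(fderiv ℝ v z (0, 1) / v z ^ 2) * v z = -(dt v z * (v z)⁻¹) := by field_simp
  have e2 : (v z)⁻¹ * (-(dt v z * (v z)⁻¹) * v z) = -(dt v z * (v z)⁻¹) := by field_simp
  rw [e1, e2, two_mul, add_smul]
  abel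

theorem dx_inner_dt_self (h : IsLocalFlow W G Γ γ v) (hz : z ∈ W) :
    (v z)⁻¹ * dx (fun w => G (γ w, w.2) (dt γ w) (dt γ w)) z =
      2 * G (γ z, z.2) (dsCurv Γ γ v z) (dt γ z) := by
  have hv := h.speed_pos hz
  rw [h.dx_inner hz h.contDiffOn_dt h.contDiffOn_dt, h.symm z hz (dt γ z), h.covD_dt_eq hz]
  simp only [map_smul, _root_.smul_apply, smul_eq_mul]
  field_simp
  ring

/-- Trades the second-order term of the evolution of `H` for `(k²)_ss`, at the cost of `-2 |∇_S
H|²`. -/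
theorem dx_dx_inner_dt_self (h : IsLocalFlow W G Γ γ v) (hz : z ∈ W) :
    (v z)⁻¹ * dx (fun y => (v y)⁻¹ * dx (fun w => G (γ w, w.2) (dt γ w) (dt γ w)) y) z =
      2 * (v z)⁻¹ * G (γ z, z.2) (covD Γ γ (1, 0) (dsCurv Γ γ v) z) (dt γ z) +
      2 * G (γ z, z.2) (dsCurv Γ γ v z) (dsCurv Γ γ v z) := by
  have hv := h.speed_pos hz
  have h1 : (fun y => (v y)⁻¹ * dx (fun w => G (γ w, w.2) (dt γ w) (dt γ w)) y) =ᶠ[𝓝 z]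
      fun w => 2 * G (γ w, w.2) (dsCurv Γ γ v w) (dt γ w) :=
    eventually_of_mem (h.isOpen.mem_nhds hz) fun w hw => h.dx_inner_dt_self hw
  have h2 := h.dx_inner hz h.contDiffOn_dsCurv h.contDiffOn_dt
  rw [dx] at h2
  rw [dx, h1.fderiv_eq, fderiv_const_mul (h.differentiableAt
    (h.contDiffOn_metric_apply h.contDiffOn_dsCurv h.contDiffOn_dt) hz), _root_.smul_apply,
    smul_eq_mul, h2, h.covD_dt_eq hz, map_smul, smul_eq_mul]
  field_simp

/-- Evolution of the squared curvature. -/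
theorem dt_inner_dt_self (h : IsLocalFlow W G Γ γ v) (hz : z ∈ W) :
    ∃ Q, 0 ≤ Q ∧
      dx (fun w => G (γ w, w.2) (dt γ w) (dt γ w)) z ^ 2 ≤
        4 * v z ^ 2 * G (γ z, z.2) (dt γ z) (dt γ z) * Q ∧
      dt (fun w => G (γ w, w.2) (dt γ w) (dt γ w)) z =
        (v z)⁻¹ * dx (fun y => (v y)⁻¹ * dx (fun w => G (γ w, w.2) (dt γ w) (dt γ w)) y) z
        - 2 * Q + 2 * G (γ z, z.2) (dt γ z) (dt γ z) ^ 2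
        + (fderiv ℝ G (γ z, z.2) (0, 1) (dt γ z) (dt γ z)
          - 2 * fderiv ℝ G (γ z, z.2) (0, 1) (unitField v γ z) (unitField v γ z)
            * G (γ z, z.2) (dt γ z) (dt γ z)
          + 2 * (v z)⁻¹ * G (γ z, z.2) (curvOp Γ γ (0, 1) (1, 0) z (unitField v γ z))
            (dt γ z)) := by
  have hv := h.speed_pos hz
  set g := G (γ z, z.2) with hg
  set S := unitField v γ z with hS
  set H := dt γ z with hH
  set P := dsCurv Γ γ v z with hP
  have hsymm : ∀ u w, g u w = g w u := h.symm z hz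
  have hpos : ∀ u, 0 ≤ g u u := fun u => by
    rcases eq_or_ne u 0 with rfl | hu
    · simp
    · exact (h.pos z hz u hu).le
  have hSS : g S S = 1 := h.inner_unitField hz
  have hHS : g H S = 0 := h.inner_dt_unitField hz
  have hPS : g P S = -g H H := h.inner_dsCurv_unitField hz
  have hcs : ∀ u w, g u w ^ 2 ≤ g u u * g w w :=
    sq_le_of_posDef hsymm (h.pos z hz)
  -- Since `g(P, S) = -k²`, the vector `P + k² S` is the normal part of `P = ∇_S H`. Its squared
  -- norm is the witness `Q`, and Cauchy-Schwarz against `H` gives the gradient bound.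
  have hN : g (P + g H H • S) (P + g H H • S) = g P P - g H H ^ 2 := by
    simp only [map_add, map_smul, _root_.add_apply, _root_.smul_apply, smul_eq_mul, hSS, hPS,
      hsymm S P]
    ring
  have hNH : g (P + g H H • S) H = g P H := by
    simp only [map_add, map_smul, _root_.add_apply, _root_.smul_apply, smul_eq_mul, hsymm S H, hHS]
    ring
  refine ⟨g P P - g H H ^ 2, hN ▸ hpos _, ?_, ?_⟩
  · have h1 := h.dx_inner_dt_self hz
    have h2 := hcs (P + g H H • S) H
    rw [hN, hNH] at h2
    rw [inv_mul_eq_div, div_eq_iff hv.ne'] at h1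
    rw [h1]
    nlinarith [mul_le_mul_of_nonneg_left h2 (sq_nonneg (v z))]
  -- The two factors `-v_t / v` contribute `4 k⁴`, and `-2 |∇_S H|² = -2Q - 2 k⁴`, which leaves `2
  -- k⁴`. The tangential term drops out because `g(S, H) = 0`.
  · rw [h.dt_inner_self hz h.contDiffOn_dt, h.dx_dx_inner_dt_self hz, h.covD_dt_dt hz,
      h.dt_speed hz]
    simp only [← hg, ← hS, ← hH, ← hP, map_add, map_smul, _root_.add_apply, _root_.smul_apply,
      smul_eq_mul, hsymm S H, hHS]
    field_simp
    ring

end IsLocalFlow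

end Connection

/-! ### Bounding the error terms by local bounds on the geometry. -/

section Bounds

variable {E : Type*} [NormedAddCommGroup E] [NormedSpace ℝ E]

/-- Bounds on a metric, its connection and their derivatives at a point. -/
structure IsBoundedAt (B : ℝ) (G : E →L[ℝ] E →L[ℝ] ℝ) (DG : E × ℝ →L[ℝ] E →L[ℝ] E →L[ℝ] ℝ)
    (Γ : E →L[ℝ] E →L[ℝ] E) (DΓ : E × ℝ →L[ℝ] E →L[ℝ] E →L[ℝ] E) : Prop where
  one_le : 1 ≤ B
  metric : ‖G‖ ≤ B
  deriv_metric : ∀ p, ‖DG p‖ ≤ B * ‖p‖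
  conn : ‖Γ‖ ≤ B
  deriv_conn : ∀ p, ‖DΓ p‖ ≤ B * ‖p‖
  elliptic : ∀ w, ‖w‖ ^ 2 ≤ B * G w w

/-- In coordinates `|S|² ≤ B` and `|H| ≤ B k`. All terms are quadratic in `H` except the one with
the time derivative of the connection, which is linear and accounts for the square root on the
right. -/
theorem IsBoundedAt.norm_error_le {B : ℝ} {g : E →L[ℝ] E →L[ℝ] ℝ}
    {Dg : E × ℝ →L[ℝ] E →L[ℝ] E →L[ℝ] ℝ} {Γ : E →L[ℝ] E →L[ℝ] E}
    {DΓ : E × ℝ →L[ℝ] E →L[ℝ] E →L[ℝ] E} (hB : IsBoundedAt B g Dg Γ DΓ) {S H : E}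
    (hS : g S S = 1) (hH : 0 ≤ g H H) :
    Dg (0, 1) H H - 2 * Dg (0, 1) S S * g H H + 2 * g (DΓ (H, 1) S S - DΓ (S, 0) H S
      + Γ H (Γ S S) - Γ S (Γ H S)) H ≤
      (3 * B ^ 2 + 2 * (B ^ 4 * (2 + 2 * B))) * (g H H + √(g H H)) := by
  have hB1 := hB.one_le
  have hB0 : 0 ≤ B := zero_le_one.trans hB1
  have hS2 : ‖S‖ ^ 2 ≤ B := by simpa [hS] using hB.elliptic S
  have hH2 : ‖H‖ ^ 2 ≤ B * g H H := hB.elliptic H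
  have hs := Real.sqrt_nonneg (g H H)
  have hs2 := Real.sq_sqrt hH
  have hH1 : ‖H‖ ≤ B * √(g H H) := by
    refine abs_le_of_sq_le_sq' ?_ (by positivity) |>.2
    calc ‖H‖ ^ 2 ≤ B * g H H := hH2
      _ ≤ B ^ 2 * g H H := by gcongr; nlinarith
      _ = (B * √(g H H)) ^ 2 := by rw [mul_pow, hs2]
  have happ : ∀ (L : E →L[ℝ] E →L[ℝ] ℝ), ‖L‖ ≤ B → ∀ u w, |L u w| ≤ B * ‖u‖ * ‖w‖ :=
    fun L hL u w => (L.le_opNorm₂ u w).trans (by gcongr)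
  have hunit : ‖((0 : E), (1 : ℝ))‖ = 1 := by simp
  have hDg : ‖Dg (0, 1)‖ ≤ B := by
    simpa [hunit] using hB.deriv_metric (0, 1)
  have h1 : |Dg (0, 1) H H| ≤ B ^ 2 * g H H := by
    calc |Dg (0, 1) H H| ≤ B * ‖H‖ * ‖H‖ := happ _ hDg H H
      _ = B * ‖H‖ ^ 2 := by ring
      _ ≤ B * (B * g H H) := by gcongr
      _ = _ := by ring
  have h2 : |Dg (0, 1) S S| ≤ B ^ 2 := by
    calc |Dg (0, 1) S S| ≤ B * ‖S‖ * ‖S‖ := happ _ hDg S S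
      _ = B * ‖S‖ ^ 2 := by ring
      _ ≤ B * B := by gcongr
      _ = _ := by ring
  have hDΓ : ∀ p u w, ‖DΓ p u w‖ ≤ B * ‖p‖ * ‖u‖ * ‖w‖ := fun p u w =>
    ((DΓ p).le_opNorm₂ u w).trans (by gcongr; exact hB.deriv_conn p)
  have hΓ : ∀ u w, ‖Γ u w‖ ≤ B * ‖u‖ * ‖w‖ := fun u w =>
    (Γ.le_opNorm₂ u w).trans (by gcongr; exact hB.conn)
  have e1 : ‖DΓ (H, 1) S S‖ ≤ B * (‖H‖ + 1) * ‖S‖ ^ 2 := by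
    refine (hDΓ (H, 1) S S).trans ?_
    have : ‖(H, (1 : ℝ))‖ ≤ ‖H‖ + 1 := by
      rw [Prod.norm_def]
      simp only [norm_one]
      exact max_le (by linarith [norm_nonneg H]) (by linarith [norm_nonneg H])
    calc B * ‖(H, (1 : ℝ))‖ * ‖S‖ * ‖S‖ ≤ B * (‖H‖ + 1) * ‖S‖ * ‖S‖ := by gcongr
      _ = _ := by ring
  have e2 : ‖DΓ (S, 0) H S‖ ≤ B * ‖H‖ * ‖S‖ ^ 2 := by
    refine (hDΓ (S, 0) H S).trans (le_of_eq ?_)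
    rw [Prod.norm_def]
    simp only [norm_zero, norm_nonneg, sup_of_le_left]
    ring
  have e3 : ‖Γ H (Γ S S)‖ ≤ B ^ 2 * ‖H‖ * ‖S‖ ^ 2 := by
    refine (hΓ _ _).trans ?_
    calc B * ‖H‖ * ‖Γ S S‖ ≤ B * ‖H‖ * (B * ‖S‖ * ‖S‖) := by gcongr; exact hΓ _ _
      _ = _ := by ring
  have e4 : ‖Γ S (Γ H S)‖ ≤ B ^ 2 * ‖H‖ * ‖S‖ ^ 2 := by
    refine (hΓ _ _).trans ?_
    calc B * ‖S‖ * ‖Γ H S‖ ≤ B * ‖S‖ * (B * ‖H‖ * ‖S‖) := by gcongr; exact hΓ _ _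
      _ = _ := by ring
  set X := DΓ (H, 1) S S - DΓ (S, 0) H S + Γ H (Γ S S) - Γ S (Γ H S) with hX
  have hXn : ‖X‖ ≤ B ^ 2 * ((2 + 2 * B) * ‖H‖ + 1) := by
    calc ‖X‖ ≤ ‖DΓ (H, 1) S S‖ + ‖DΓ (S, 0) H S‖ + ‖Γ H (Γ S S)‖ + ‖Γ S (Γ H S)‖ :=
          (norm_sub_le _ _).trans (by
            gcongr
            exact (norm_add_le _ _).trans (by gcongr; exact norm_sub_le _ _))
      _ ≤ B * (‖H‖ + 1) * ‖S‖ ^ 2 + B * ‖H‖ * ‖S‖ ^ 2 + B ^ 2 * ‖H‖ * ‖S‖ ^ 2 +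
          B ^ 2 * ‖H‖ * ‖S‖ ^ 2 := by gcongr
      _ = (B * ((2 + 2 * B) * ‖H‖ + 1)) * ‖S‖ ^ 2 := by ring
      _ ≤ (B * ((2 + 2 * B) * ‖H‖ + 1)) * B := by gcongr
      _ = _ := by ring
  have h3 : |g X H| ≤ B ^ 4 * (2 + 2 * B) * (g H H + √(g H H)) := by
    calc |g X H| ≤ B * ‖X‖ * ‖H‖ := happ g hB.metric X H
      _ ≤ B * (B ^ 2 * ((2 + 2 * B) * ‖H‖ + 1)) * ‖H‖ := by gcongr
      _ = B ^ 3 * ((2 + 2 * B) * ‖H‖ ^ 2 + ‖H‖) := by ring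
      _ ≤ B ^ 3 * ((2 + 2 * B) * (B * g H H) + B * √(g H H)) := by gcongr
      _ = B ^ 4 * ((2 + 2 * B) * g H H + 1 * √(g H H)) := by ring
      _ ≤ B ^ 4 * ((2 + 2 * B) * g H H + (2 + 2 * B) * √(g H H)) := by gcongr; linarith
      _ = _ := by ring
  have h4 : -(2 * Dg (0, 1) S S * g H H) ≤ 2 * B ^ 2 * g H H := by
    have := mul_le_mul_of_nonneg_right (neg_le_of_abs_le h2) hH
    linarith
  have h5 : 0 ≤ B ^ 2 * √(g H H) := by positivity
  linarith [le_abs_self (Dg (0, 1) H H), le_abs_self (g X H)]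

variable {G : E × ℝ → E →L[ℝ] E →L[ℝ] ℝ} {Γ : E × ℝ → E →L[ℝ] E →L[ℝ] E} {γ : ℝ × ℝ → E}
  {z : ℝ × ℝ} {W : Set (ℝ × ℝ)} {v : ℝ × ℝ → ℝ}

/-- Linearity in `X = v S` extracts a factor `v`, which cancels the `v⁻¹` in the evolution of `k²`;
the error bound is then independent of the parametrization. -/
theorem IsLocalFlow.curvOp_eq (h : IsLocalFlow W G Γ γ v) (hz : z ∈ W) :
    curvOp Γ γ (0, 1) (1, 0) z (unitField v γ z) =
      v z • (fderiv ℝ Γ (γ z, z.2) (dt γ z, 1) (unitField v γ z) (unitField v γ z)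
        - fderiv ℝ Γ (γ z, z.2) (unitField v γ z, 0) (dt γ z) (unitField v γ z)
        + Γ (γ z, z.2) (dt γ z) (Γ (γ z, z.2) (unitField v γ z) (unitField v γ z))
        - Γ (γ z, z.2) (unitField v γ z) (Γ (γ z, z.2) (dt γ z) (unitField v γ z))) := by
  have h1 : fderiv ℝ γ z (1, 0) = v z • unitField v γ z := h.dx_eq hz
  have h2 : ((v z • unitField v γ z, (0 : ℝ)) : E × ℝ) = v z • (unitField v γ z, (0 : ℝ)) := by
    simp
  rw [curvOp, h1, h2]
  simp only [map_smul, _root_.smul_apply, smul_add, smul_sub]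

/-- Differential inequality for the squared curvature, with a constant that depends only on local
bounds of the metric and its connection. -/
theorem IsLocalFlow.dt_curv_le (h : IsLocalFlow W G Γ γ v) (hz : z ∈ W) {B : ℝ}
    (hB : IsBoundedAt B (G (γ z, z.2)) (fderiv ℝ G (γ z, z.2)) (Γ (γ z, z.2))
      (fderiv ℝ Γ (γ z, z.2))) :
    ∃ Q, 0 ≤ Q ∧
      dx (fun w => G (γ w, w.2) (dt γ w) (dt γ w)) z ^ 2 ≤
        4 * v z ^ 2 * G (γ z, z.2) (dt γ z) (dt γ z) * Q ∧
      dt (fun w => G (γ w, w.2) (dt γ w) (dt γ w)) z ≤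
        (v z)⁻¹ * dx (fun y => (v y)⁻¹ * dx (fun w => G (γ w, w.2) (dt γ w) (dt γ w)) y) z
        - 2 * Q + 2 * G (γ z, z.2) (dt γ z) (dt γ z) ^ 2
        + (3 * B ^ 2 + 2 * (B ^ 4 * (2 + 2 * B))) *
          (G (γ z, z.2) (dt γ z) (dt γ z) + √(G (γ z, z.2) (dt γ z) (dt γ z))) := by
  obtain ⟨Q, hQ, h1, h2⟩ := h.dt_inner_dt_self hz
  refine ⟨Q, hQ, h1, h2.trans_le ?_⟩
  have hH : 0 ≤ G (γ z, z.2) (dt γ z) (dt γ z) := by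
    rcases eq_or_ne (dt γ z) 0 with h0 | h0
    · rw [h0]; simp
    · exact (h.pos z hz _ h0).le
  have h3 := hB.norm_error_le (h.inner_unitField hz) hH
  have hv := (h.speed_pos hz).ne'
  rw [h.curvOp_eq hz, map_smul, _root_.smul_apply, smul_eq_mul, ← mul_assoc,
    inv_mul_cancel_right₀ hv]
  linarith

end Bounds

/-! ### The Levi-Civita connection of a family of metrics, smooth up to the end times. -/

section Christoffel

set_option maxSynthPendingDepth 3

variable {n : ℕ}

/-- A smooth family of metrics on an open set `U` of `ℝⁿ`, for times in `[0, T]`. -/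
structure IsMetricFamily (U : Set (Coord n)) (T : ℝ)
    (G : Coord n × ℝ → Coord n →L[ℝ] Coord n →L[ℝ] ℝ) : Prop where
  isOpen : IsOpen U
  time_pos : 0 < T
  contDiffOn : ContDiffOn ℝ ∞ G (U ×ˢ Icc 0 T)
  symm : ∀ z ∈ U ×ˢ Icc 0 T, ∀ u w, G z u w = G z w u
  pos : ∀ z ∈ U ×ˢ Icc 0 T, ∀ u, u ≠ 0 → 0 < G z u u

/-- The space derivative of a time-dependent family of bilinear forms on `D`. -/
def spaceDeriv (G : Coord n × ℝ → Coord n →L[ℝ] Coord n →L[ℝ] ℝ) (D : Set (Coord n × ℝ))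
    (z : Coord n × ℝ) : Coord n →L[ℝ] Coord n →L[ℝ] Coord n →L[ℝ] ℝ :=
  (fderivWithin ℝ G D z).comp (ContinuousLinearMap.inl ℝ (Coord n) ℝ)

/-- The Christoffel symbols of the first kind. -/
def christoffelForm (L : Coord n →L[ℝ] Coord n →L[ℝ] Coord n →L[ℝ] ℝ) :
    Coord n →L[ℝ] Coord n →L[ℝ] Coord n →L[ℝ] ℝ :=
  (1 / 2 : ℝ) • (L + L.flip - ((ContinuousLinearMap.flipₗᵢ ℝ (Coord n) (Coord n)
    ℝ).toContinuousLinearEquiv.toContinuousLinearMap).comp L.flip)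

theorem christoffelForm_apply (L : Coord n →L[ℝ] Coord n →L[ℝ] Coord n →L[ℝ] ℝ)
    (v w : Coord n) :
    christoffelForm L v w = (1 / 2 : ℝ) • (L v w + L w v - (L.flip v).flip w) := by
  ext u
  simp [christoffelForm]

/-- The Levi-Civita connection of a time-dependent metric, as a field of bilinear maps. -/
def conn (G : Coord n × ℝ → Coord n →L[ℝ] Coord n →L[ℝ] ℝ) (D : Set (Coord n × ℝ))
    (z : Coord n × ℝ) : Coord n →L[ℝ] Coord n →L[ℝ] Coord n :=
  (ContinuousLinearMap.compL ℝ (Coord n) (Coord n →L[ℝ] ℝ) (Coord n) (G z).inverse).comp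
    (christoffelForm (spaceDeriv G D z))

theorem conn_apply (G : Coord n × ℝ → Coord n →L[ℝ] Coord n →L[ℝ] ℝ) (D : Set (Coord n × ℝ))
    (z : Coord n × ℝ) (v w : Coord n) :
    conn G D z v w = (G z).inverse (christoffelForm (spaceDeriv G D z) v w) := rfl

/-- Definiteness gives injectivity, and dimensions agree. This guarantees that `inverse` is a true
inverse and not its default value `0`. -/
theorem exists_equiv_of_pos {g : Coord n →L[ℝ] Coord n →L[ℝ] ℝ} (hg : ∀ u, u ≠ 0 → 0 < g u u) :
    ∃ e : Coord n ≃L[ℝ] (Coord n →L[ℝ] ℝ), (e : Coord n →L[ℝ] Coord n →L[ℝ] ℝ) = g := by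
  have hinj : Function.Injective (g : Coord n →ₗ[ℝ] Coord n →L[ℝ] ℝ) := by
    refine (injective_iff_map_eq_zero _).2 fun u hu => ?_
    by_contra h
    have h1 := hg u h
    have h2 : g u = 0 := hu
    rw [h2] at h1
    simp at h1
  have hdim : Module.finrank ℝ (Coord n) = Module.finrank ℝ (Coord n →L[ℝ] ℝ) := by
    rw [← (LinearMap.toContinuousLinearMap (𝕜 := ℝ) (E := Coord n) (F' := ℝ)).finrank_eq]
    exact Subspace.dual_finrank_eq.symm
  refine ⟨(LinearMap.linearEquivOfInjective _ hinj hdim).toContinuousLinearEquiv, ?_⟩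
  ext u w
  rfl

variable {U : Set (Coord n)} {T : ℝ} {G : Coord n × ℝ → Coord n →L[ℝ] Coord n →L[ℝ] ℝ}

namespace IsMetricFamily

theorem uniqueDiffOn (h : IsMetricFamily U T G) : UniqueDiffOn ℝ (U ×ˢ Icc 0 T) :=
  h.isOpen.uniqueDiffOn.prod (uniqueDiffOn_Icc h.time_pos)

theorem apply_inverse (h : IsMetricFamily U T G) {z : Coord n × ℝ} (hz : z ∈ U ×ˢ Icc 0 T)
    (φ : Coord n →L[ℝ] ℝ) : G z ((G z).inverse φ) = φ := by
  obtain ⟨e, he⟩ := exists_equiv_of_pos (h.pos z hz)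
  rw [← he, ContinuousLinearMap.inverse_equiv]
  exact e.apply_symm_apply φ

theorem contDiffOn_inverse (h : IsMetricFamily U T G) :
    ContDiffOn ℝ ∞ (fun z => (G z).inverse) (U ×ˢ Icc 0 T) := by
  intro z hz
  obtain ⟨e, he⟩ := exists_equiv_of_pos (h.pos z hz)
  have h1 := contDiffAt_map_inverse (𝕜 := ℝ) (n := ∞) e
  rw [he] at h1
  exact h1.comp_contDiffWithinAt z (h.contDiffOn z hz)

theorem contDiffOn_spaceDeriv (h : IsMetricFamily U T G) :
    ContDiffOn ℝ ∞ (spaceDeriv G (U ×ˢ Icc 0 T)) (U ×ˢ Icc 0 T) :=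
  (h.contDiffOn.fderivWithin h.uniqueDiffOn (m := ∞) (by simp)).clm_comp contDiffOn_const

theorem contDiffOn_conn (h : IsMetricFamily U T G) :
    ContDiffOn ℝ ∞ (conn G (U ×ˢ Icc 0 T)) (U ×ˢ Icc 0 T) := by
  have hL : ∀ u v w, ContDiffOn ℝ ∞ (fun z => spaceDeriv G (U ×ˢ Icc 0 T) z u v w)
      (U ×ˢ Icc 0 T) := fun u v w =>
    ((h.contDiffOn_spaceDeriv.clm_apply contDiffOn_const).clm_apply contDiffOn_const).clm_apply
      contDiffOn_const
  refine contDiffOn_clm_apply.2 fun v => contDiffOn_clm_apply.2 fun w => ?_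
  have hC : ∀ u, ContDiffOn ℝ ∞
      (fun z => christoffelForm (spaceDeriv G (U ×ˢ Icc 0 T) z) v w u) (U ×ˢ Icc 0 T) := fun u => by
    simp only [christoffelForm_apply]
    exact contDiffOn_const.mul (((hL v w u).add (hL w v u)).sub (hL u v w))
  exact h.contDiffOn_inverse.clm_apply (contDiffOn_clm_apply.2 hC)

/-- As `U` is open, the derivative in space is two-sided even at the end times, where only a
derivative within the strip is available in space-time. -/
theorem hasFDerivAt_slice (h : IsMetricFamily U T G) {y : Coord n} {t : ℝ} (hy : y ∈ U)
    (ht : t ∈ Icc 0 T) :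
    HasFDerivAt (fun x => G (x, t)) (spaceDeriv G (U ×ˢ Icc 0 T) (y, t)) y := by
  have h1 : HasFDerivWithinAt G (fderivWithin ℝ G (U ×ˢ Icc 0 T) (y, t)) (U ×ˢ Icc 0 T) (y, t) :=
    ((h.contDiffOn (y, t) ⟨hy, ht⟩).differentiableWithinAt (by simp)).hasFDerivWithinAt
  have h2 : HasFDerivWithinAt (fun x : Coord n => (x, t))
      (ContinuousLinearMap.inl ℝ (Coord n) ℝ) U y := (hasFDerivAt_prodMk_left y t).hasFDerivWithinAt
  have h3 : MapsTo (fun x : Coord n => (x, t)) U (U ×ˢ Icc 0 T) := fun x hx => ⟨hx, ht⟩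
  exact (HasFDerivWithinAt.comp (g := G) y h1 h2 h3).hasFDerivAt
    (h.isOpen.mem_nhds hy)

theorem christoffel_eq (h : IsMetricFamily U T G) {y : Coord n} {t : ℝ} (hy : y ∈ U)
    (ht : t ∈ Icc 0 T) (v w : Coord n) :
    christoffel (fun x => G (x, t)) y v w = conn G (U ×ˢ Icc 0 T) (y, t) v w := by
  rw [christoffel, conn_apply, christoffelForm_apply, (h.hasFDerivAt_slice hy ht).fderiv]

theorem spaceDeriv_symm (h : IsMetricFamily U T G) {z : Coord n × ℝ} (hz : z ∈ U ×ˢ Icc 0 T)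
    (u v w : Coord n) :
    spaceDeriv G (U ×ˢ Icc 0 T) z u v w = spaceDeriv G (U ×ˢ Icc 0 T) z u w v := by
  obtain ⟨y, t⟩ := z
  have hs := h.hasFDerivAt_slice hz.1 hz.2
  have e : ∀ a b, fderiv ℝ (fun x => G (x, t) a b) y u =
      spaceDeriv G (U ×ˢ Icc 0 T) (y, t) u a b := fun a b => by
    have h1 := (hs.clm_apply (hasFDerivAt_const a y)).clm_apply (hasFDerivAt_const b y)
    rw [h1.fderiv]
    simp
  rw [← e v w, ← e w v]
  have h2 : (fun x => G (x, t) v w) =ᶠ[𝓝 y] fun x => G (x, t) w v :=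
    eventually_of_mem (h.isOpen.mem_nhds hz.1) fun x hx => h.symm (x, t) ⟨hx, hz.2⟩ v w
  rw [h2.fderiv_eq]

theorem conn_symm (h : IsMetricFamily U T G) {z : Coord n × ℝ} (hz : z ∈ U ×ˢ Icc 0 T)
    (v w : Coord n) : conn G (U ×ˢ Icc 0 T) z v w = conn G (U ×ˢ Icc 0 T) z w v := by
  rw [conn_apply, conn_apply]
  congr 1
  ext u
  simp only [christoffelForm_apply, _root_.smul_apply, _root_.sub_apply, _root_.add_apply,
    ContinuousLinearMap.flip_apply]
  rw [h.spaceDeriv_symm hz u v w]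
  ring_nf

/-- Lowering the index turns both terms into Christoffel symbols of the first kind, in whose sum all
but one derivative of the metric cancel. -/
theorem compat (h : IsMetricFamily U T G) {z : Coord n × ℝ} (hz : z ∈ U ×ˢ Icc 0 T)
    (u v w : Coord n) :
    spaceDeriv G (U ×ˢ Icc 0 T) z u v w =
      G z (conn G (U ×ˢ Icc 0 T) z u v) w + G z v (conn G (U ×ˢ Icc 0 T) z u w) := by
  rw [h.symm z hz v, conn_apply, conn_apply, h.apply_inverse hz, h.apply_inverse hz]
  simp only [christoffelForm_apply, _root_.smul_apply, _root_.sub_apply, _root_.add_apply,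
    ContinuousLinearMap.flip_apply, smul_eq_mul]
  rw [h.spaceDeriv_symm hz u w v, h.spaceDeriv_symm hz v u w, h.spaceDeriv_symm hz w u v]
  ring

theorem mem_nhds (h : IsMetricFamily U T G) {y : Coord n} {t : ℝ} (hy : y ∈ U)
    (ht : t ∈ Ioo 0 T) : U ×ˢ Icc 0 T ∈ 𝓝 (y, t) :=
  prod_mem_nhds (h.isOpen.mem_nhds hy) (Icc_mem_nhds ht.1 ht.2)

theorem exists_fderivWithin_bound {F : Type*} [NormedAddCommGroup F] [NormedSpace ℝ F]
    {K : Coord n × ℝ → F} {D C : Set (Coord n × ℝ)} (hD : UniqueDiffOn ℝ D)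
    (hK : ContDiffOn ℝ ∞ K D) (hC : IsCompact C) (hCD : C ⊆ D) :
    ∃ B, ∀ z ∈ C, ‖K z‖ ≤ B ∧ ∀ p, ‖fderivWithin ℝ K D z p‖ ≤ B * ‖p‖ := by
  obtain ⟨B₁, h1⟩ := hC.exists_bound_of_continuousOn (hK.continuousOn.mono hCD)
  obtain ⟨B₂, h2⟩ := hC.exists_bound_of_continuousOn
    ((hK.continuousOn_fderivWithin hD (by simp)).mono hCD)
  refine ⟨max B₁ B₂, fun z hz => ⟨(h1 z hz).trans (le_max_left _ _), fun p => ?_⟩⟩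
  refine (ContinuousLinearMap.le_opNorm _ p).trans ?_
  gcongr
  exact (h2 z hz).trans (le_max_right _ _)

/-- `1 / G(w, w)` is bounded on the product of `C` with the unit sphere, which is compact;
homogeneity does the rest. -/
theorem exists_elliptic (h : IsMetricFamily U T G) {C : Set (Coord n × ℝ)} (hC : IsCompact C)
    (hCD : C ⊆ U ×ˢ Icc 0 T) : ∃ B, ∀ z ∈ C, ∀ w, ‖w‖ ^ 2 ≤ B * G z w w := by
  have hne : ∀ q ∈ C ×ˢ _root_.Metric.sphere (0 : Coord n) 1, 0 < G q.1 q.2 q.2 := fun q hq =>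
    h.pos q.1 (hCD hq.1) q.2 (ne_zero_of_mem_unit_sphere ⟨q.2, hq.2⟩)
  have hG : ContinuousOn (fun q : (Coord n × ℝ) × Coord n => G q.1)
      (C ×ˢ _root_.Metric.sphere (0 : Coord n) 1) :=
    h.contDiffOn.continuousOn.comp continuousOn_fst fun q hq => hCD hq.1
  obtain ⟨B, hB⟩ := (hC.prod (isCompact_sphere (0 : Coord n) 1)).exists_bound_of_continuousOn
    (f := fun q : (Coord n × ℝ) × Coord n => (G q.1 q.2 q.2)⁻¹)
    (((hG.clm_apply continuousOn_snd).clm_apply continuousOn_snd).inv₀ fun q hq => (hne q hq).ne')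
  refine ⟨B, fun z hz w => ?_⟩
  rcases eq_or_ne w 0 with rfl | hw
  · simp
  have hw' : 0 < ‖w‖ := norm_pos_iff.2 hw
  have hmem : (z, ‖w‖⁻¹ • w) ∈ C ×ˢ _root_.Metric.sphere (0 : Coord n) 1 :=
    ⟨hz, by simp [norm_smul, hw'.ne']⟩
  have h1 := (le_abs_self _).trans (hB _ hmem)
  have h2 := h.pos z (hCD hz) w hw
  simp only [map_smul, _root_.smul_apply, smul_eq_mul] at h1
  have e : (‖w‖⁻¹ * (‖w‖⁻¹ * G z w w))⁻¹ = ‖w‖ ^ 2 / G z w w := by field_simp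
  rwa [e, div_le_iff₀ h2] at h1

theorem exists_bound (h : IsMetricFamily U T G) {C : Set (Coord n × ℝ)} (hC : IsCompact C)
    (hCD : C ⊆ U ×ˢ Icc 0 T) :
    ∃ B, ∀ z ∈ C, IsBoundedAt B (G z) (fderivWithin ℝ G (U ×ˢ Icc 0 T) z)
      (conn G (U ×ˢ Icc 0 T) z) (fderivWithin ℝ (conn G (U ×ˢ Icc 0 T)) (U ×ˢ Icc 0 T) z) := by
  obtain ⟨B₁, h1⟩ := exists_fderivWithin_bound h.uniqueDiffOn h.contDiffOn hC hCD
  obtain ⟨B₂, h2⟩ := exists_fderivWithin_bound h.uniqueDiffOn h.contDiffOn_conn hC hCD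
  obtain ⟨B₃, h3⟩ := h.exists_elliptic hC hCD
  have l1 : B₁ ≤ max 1 (max B₁ (max B₂ B₃)) := by simp
  have l2 : B₂ ≤ max 1 (max B₁ (max B₂ B₃)) := by simp
  have l3 : B₃ ≤ max 1 (max B₁ (max B₂ B₃)) := by simp
  refine ⟨max 1 (max B₁ (max B₂ B₃)), fun z hz => ⟨le_max_left _ _, (h1 z hz).1.trans l1,
    fun p => ((h1 z hz).2 p).trans (by gcongr), (h2 z hz).1.trans l2,
    fun p => ((h2 z hz).2 p).trans (by gcongr), fun w => (h3 z hz w).trans ?_⟩⟩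
  rcases eq_or_ne w 0 with rfl | hw
  · simp
  · have := (h.pos z (hCD hz) w hw).le
    gcongr

end IsMetricFamily

end Christoffel

/-! ### Metrics and velocities through charts. -/

section Chart

variable {n : ℕ} {M : Type*} [TopologicalSpace M] [ChartedSpace (Coord n) M]
  [IsManifold (𝓡 n) ∞ M]

/-- The metric at a point, as a form on `ℝⁿ`. -/
def innerAt (g : Metric n M) (q : M) : Coord n →L[ℝ] Coord n →L[ℝ] ℝ := g.inner q

theorem innerAt_symm (g : Metric n M) (q : M) (v w : Coord n) :
    innerAt g q v w = innerAt g q w v :=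
  Bundle.ContMDiffRiemannianMetric.symm g q v w

theorem innerAt_pos (g : Metric n M) (q : M) {v : Coord n} (hv : v ≠ 0) : 0 < innerAt g q v v :=
  Bundle.ContMDiffRiemannianMetric.pos g q v hv

theorem chartMetric_apply (g : Metric n M) (p : M) (y v w : Coord n) :
    chartMetric g p y v w = innerAt g ((extChartAt (𝓡 n) p).symm y) (chartFrame p y v)
      (chartFrame p y w) := rfl

theorem chartFrame_injective (p : M) {y : Coord n} (hy : y ∈ (extChartAt (𝓡 n) p).target) :
    Function.Injective (chartFrame p y) := by
  have : IsManifold (𝓡 n) 1 M := IsManifold.of_le (n := ∞) (by simp)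
  have h := isInvertible_mfderivWithin_extChartAt_symm hy
  rw [ModelWithCorners.range_eq_univ, mfderivWithin_univ] at h
  obtain ⟨e, he⟩ := h
  intro v w hvw
  have h1 : e v = e w := by
    have : ∀ u : Coord n, e u = chartFrame p y u := fun u => congrArg (fun L => L u) he
    rw [this, this]
    exact hvw
  exact e.injective h1

theorem chartMetric_symm (g : Metric n M) (p : M) (y v w : Coord n) :
    chartMetric g p y v w = chartMetric g p y w v := by
  rw [chartMetric_apply, chartMetric_apply, innerAt_symm]

theorem chartMetric_pos (g : Metric n M) (p : M) {y : Coord n}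
    (hy : y ∈ (extChartAt (𝓡 n) p).target) {v : Coord n} (hv : v ≠ 0) :
    0 < chartMetric g p y v v := by
  rw [chartMetric_apply]
  refine innerAt_pos g _ fun h => hv ?_
  exact chartFrame_injective p hy (h.trans (map_zero _).symm)

theorem IsRicciFlow.isMetricFamily {g : ℝ → Metric n M} {T : ℝ} (hT : 0 < T)
    (hg : IsRicciFlow g T) (p : M) :
    IsMetricFamily (extChartAt (𝓡 n) p).target T (fun z => chartMetric (g z.2) p z.1) where
  isOpen := isOpen_extChartAt_target p
  time_pos := hT
  contDiffOn := hg.smooth p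
  symm _z _hz u w := chartMetric_symm _ p _ u w
  pos _z hz _ hu := chartMetric_pos _ p hz.1 hu

/-- The velocity of a curve in `M`, through a chart. -/
theorem mfderivWithin_eq_chartFrame {σ : ℝ → M} {S : Set ℝ} {t : ℝ} {p : M} {γ' : Coord n}
    (hmem : σ t ∈ (extChartAt (𝓡 n) p).source) (hcont : ContinuousWithinAt σ S t)
    (hγ : HasDerivWithinAt (fun s => extChartAt (𝓡 n) p (σ s)) γ' S t)
    (hS : UniqueDiffWithinAt ℝ S t) (ht : t ∈ S) :
    (mfderivWithin 𝓘(ℝ, ℝ) (𝓡 n) σ S t (1 : ℝ) : Coord n) =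
      chartFrame p (extChartAt (𝓡 n) p (σ t)) γ' := by
  have hy : extChartAt (𝓡 n) p (σ t) ∈ (extChartAt (𝓡 n) p).target :=
    (extChartAt (𝓡 n) p).map_source hmem
  have h1 : HasMFDerivAt 𝓘(ℝ, Coord n) (𝓡 n) (extChartAt (𝓡 n) p).symm
      (extChartAt (𝓡 n) p (σ t)) (chartFrame p (extChartAt (𝓡 n) p (σ t))) :=
    (((contMDiffOn_extChartAt_symm (n := ∞) p).contMDiffAt
      ((isOpen_extChartAt_target p).mem_nhds hy)).mdifferentiableAt (by simp)).hasMFDerivAt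
  have h2 : HasMFDerivWithinAt 𝓘(ℝ, ℝ) 𝓘(ℝ, Coord n) (fun s => extChartAt (𝓡 n) p (σ s)) S t
      (ContinuousLinearMap.toSpanSingleton ℝ γ') := hγ.hasFDerivWithinAt.hasMFDerivWithinAt
  have h3 := h1.comp_hasMFDerivWithinAt t h2
  -- By continuity the curve stays in the chart domain near `t`, so composing with the chart and its
  -- inverse changes nothing there.
  have h4 : (fun s => (extChartAt (𝓡 n) p).symm (extChartAt (𝓡 n) p (σ s))) =ᶠ[𝓝[S] t] σ := by
    filter_upwards [hcont.preimage_mem_nhdsWithin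
      ((isOpen_extChartAt_source p).mem_nhds hmem)] with s hs
    exact (extChartAt (𝓡 n) p).left_inv hs
  have h5 : HasMFDerivWithinAt 𝓘(ℝ, ℝ) (𝓡 n) σ S t _ :=
    h3.congr_of_eventuallyEq h4.symm (h4.self_of_nhdsWithin ht).symm
  rw [h5.mfderivWithin (uniqueMDiffWithinAt_iff_uniqueDiffWithinAt.2 hS)]
  exact congrArg (chartFrame p _) (one_smul ℝ γ')

end Chart

/-! ### Speed and curvature of a flow as smooth functions on the strip. -/

section Flow

/-- A family of closed curves as a map on space-time. -/
def position {M : Type*} (c : Circle → ℝ → M) (z : ℝ × ℝ) : M := c (Circle.exp z.1) z.2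

/-- A family of closed curves on space-time, in the chart at `p`. -/
def chartPath (n : ℕ) {M : Type*} [TopologicalSpace M] [ChartedSpace (Coord n) M] (c : Circle → ℝ → M) (p : M) (z : ℝ × ℝ) : Coord n :=
  extChartAt (𝓡 n) p (position c z)

theorem position_add_two_pi {M : Type*} (c : Circle → ℝ → M) (x t : ℝ) :
    position c (x + 2 * Real.pi, t) = position c (x, t) := by
  simp only [position, Circle.exp_add_two_pi]

/-- The velocity `∂c/∂t`. -/
def velocity (n : ℕ) {M : Type*} [TopologicalSpace M] [ChartedSpace (Coord n) M] (T : ℝ) (c : Circle → ℝ → M) (z : ℝ × ℝ) : Coord n :=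
  mfderivWithin 𝓘(ℝ, ℝ) (𝓡 n) (fun s => position c (z.1, s)) (Icc 0 T) z.2 (1 : ℝ)

variable {n : ℕ} {M : Type*} [TopologicalSpace M] [ChartedSpace (Coord n) M]
  [IsManifold (𝓡 n) ∞ M]
  {g : ℝ → Metric n M} {T : ℝ} {c : Circle → ℝ → M}

theorem chartMetric_chartPath (g : Metric n M) {p : M} {z : ℝ × ℝ}
    (hz : position c z ∈ (extChartAt (𝓡 n) p).source) (v w : Coord n) :
    chartMetric g p (chartPath n c p z) v w = innerAt g (position c z)
      (chartFrame p (chartPath n c p z) v) (chartFrame p (chartPath n c p z) w) := by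
  rw [chartMetric_apply]
  congr 2
  rw [chartPath, (extChartAt (𝓡 n) p).left_inv hz]

namespace IsCurveShrinkingFlow

theorem contMDiffOn_position (hc : IsCurveShrinkingFlow g T c) :
    ContMDiffOn 𝓘(ℝ, ℝ × ℝ) (𝓡 n) ∞ (position c) (strip T) := by
  have h1 : ContMDiff 𝓘(ℝ, ℝ × ℝ) ((𝓡 1).prod 𝓘(ℝ, ℝ)) ∞
      (fun z : ℝ × ℝ => (Circle.exp z.1, z.2)) :=
    (contMDiff_circleExp.comp contDiff_fst.contMDiff).prodMk contDiff_snd.contMDiff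
  exact hc.smooth.comp h1.contMDiffOn fun z hz => ⟨mem_univ _, hz.2⟩

theorem preimage_source_mem (hc : IsCurveShrinkingFlow g T c) {p : M} {z : ℝ × ℝ}
    (hz : z ∈ strip T) (hp : position c z ∈ (extChartAt (𝓡 n) p).source) :
    position c ⁻¹' (extChartAt (𝓡 n) p).source ∈ 𝓝[strip T] z :=
  (hc.contMDiffOn_position.continuousOn z hz).preimage_mem_nhdsWithin
    ((isOpen_extChartAt_source p).mem_nhds hp)

theorem contDiffWithinAt_chartPath (hc : IsCurveShrinkingFlow g T c) {p : M} {z : ℝ × ℝ}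
    (hz : z ∈ strip T) (hp : position c z ∈ (extChartAt (𝓡 n) p).source) :
    ContDiffWithinAt ℝ ∞ (chartPath n c p) (strip T) z := by
  rw [← contMDiffWithinAt_iff_contDiffWithinAt]
  rw [extChartAt_source] at hp
  exact (contMDiffAt_extChartAt' hp).comp_contMDiffWithinAt z (hc.contMDiffOn_position z hz)

theorem hasFDerivWithinAt_chartPath (hc : IsCurveShrinkingFlow g T c) {p : M} {z : ℝ × ℝ}
    (hz : z ∈ strip T) (hp : position c z ∈ (extChartAt (𝓡 n) p).source) :
    HasFDerivWithinAt (chartPath n c p) (fderivWithin ℝ (chartPath n c p) (strip T) z) (strip T) z :=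
  ((hc.contDiffWithinAt_chartPath hz hp).differentiableWithinAt (by simp)).hasFDerivWithinAt

theorem hasDerivWithinAt_chartPath (hc : IsCurveShrinkingFlow g T c) {p : M} {x t : ℝ}
    (ht : t ∈ Icc 0 T) (hp : position c (x, t) ∈ (extChartAt (𝓡 n) p).source) :
    HasDerivWithinAt (fun s => chartPath n c p (x, s))
      (fderivWithin ℝ (chartPath n c p) (strip T) (x, t) (0, 1)) (Icc 0 T) t := by
  have h1 : HasDerivWithinAt (fun s : ℝ => (x, s)) ((0 : ℝ), (1 : ℝ)) (Icc 0 T) t :=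
    ((hasDerivAt_const t x).prodMk (hasDerivAt_id t)).hasDerivWithinAt
  exact (hc.hasFDerivWithinAt_chartPath ⟨mem_univ x, ht⟩ hp).comp_hasDerivWithinAt t h1
    fun s hs => ⟨mem_univ x, hs⟩

theorem hasDerivAt_chartPath (hc : IsCurveShrinkingFlow g T c) {p : M} {x t : ℝ}
    (ht : t ∈ Icc 0 T) (hp : position c (x, t) ∈ (extChartAt (𝓡 n) p).source) :
    HasDerivAt (fun y => chartPath n c p (y, t))
      (fderivWithin ℝ (chartPath n c p) (strip T) (x, t) (1, 0)) x := by
  have h1 : HasDerivWithinAt (fun s : ℝ => (s, t)) ((1 : ℝ), (0 : ℝ)) univ x :=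
    ((hasDerivAt_id x).prodMk (hasDerivAt_const x t)).hasDerivWithinAt
  have h2 : MapsTo (fun s : ℝ => (s, t)) univ (strip T) := fun s _ => ⟨mem_univ s, ht⟩
  rw [← hasDerivWithinAt_univ]
  exact (hc.hasFDerivWithinAt_chartPath ⟨mem_univ x, ht⟩ hp).comp_hasDerivWithinAt x h1 h2

theorem tangentVector_eq (hc : IsCurveShrinkingFlow g T c) {p : M} {x t : ℝ}
    (ht : t ∈ Icc 0 T) (hp : position c (x, t) ∈ (extChartAt (𝓡 n) p).source) :
    (tangentVector (n := n) c t x : Coord n) = chartFrame p (chartPath n c p (x, t))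
      (fderivWithin ℝ (chartPath n c p) (strip T) (x, t) (1, 0)) := by
  have h1 := mfderivWithin_eq_chartFrame (σ := fun y => position c (y, t)) (S := univ) (t := x) hp
    ((continuous_slice_of_strip hc.contMDiffOn_position.continuousOn ht).continuousWithinAt)
    (hc.hasDerivAt_chartPath ht hp).hasDerivWithinAt uniqueDiffWithinAt_univ (mem_univ x)
  rw [mfderivWithin_univ] at h1
  exact h1

theorem velocity_eq (hT : 0 < T) (hc : IsCurveShrinkingFlow g T c) {p : M} {x t : ℝ}
    (ht : t ∈ Icc 0 T) (hp : position c (x, t) ∈ (extChartAt (𝓡 n) p).source) {γ' : Coord n}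
    (hγ : HasDerivWithinAt (fun s => chartPath n c p (x, s)) γ' (Icc 0 T) t) :
    velocity n T c (x, t) = chartFrame p (chartPath n c p (x, t)) γ' := by
  have hcont : ContinuousWithinAt (fun s => position c (x, s)) (Icc 0 T) t :=
    (hc.contMDiffOn_position.continuousOn.comp (by fun_prop : ContinuousOn (fun s : ℝ => (x, s))
      (Icc 0 T)) fun s hs => ⟨mem_univ x, hs⟩) t ht
  exact mfderivWithin_eq_chartFrame (σ := fun s => position c (x, s)) hp hcont hγ
    (uniqueDiffOn_Icc hT t ht) ht

/-- The curvature is defined in a chart that changes with the point. The flow equation identifies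
`H` with the velocity, whose norm does not depend on a chart; periodicity and smoothness of `k²`
follow from this form. -/
theorem curvature_eq (hT : 0 < T) (hc : IsCurveShrinkingFlow g T c) {x t : ℝ}
    (ht : t ∈ Icc 0 T) :
    curvature g c t x = √(innerAt (g t) (position c (x, t)) (velocity n T c (x, t))
      (velocity n T c (x, t))) := by
  have hp : position c (x, t) ∈ (extChartAt (𝓡 n) (position c (x, t))).source :=
    mem_extChartAt_source _
  have h1 := hc.evolution (position c (x, t)) t ht x hp
  have h2 := hc.velocity_eq hT ht hp h1
  rw [h2, ← chartMetric_chartPath (g t) hp]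
  rfl

/-- The squared norm of the velocity; it agrees with the squared curvature. -/
theorem curvature_sq (hT : 0 < T) (hc : IsCurveShrinkingFlow g T c) {x t : ℝ} {p : M}
    (ht : t ∈ Icc 0 T) (hp : position c (x, t) ∈ (extChartAt (𝓡 n) p).source) :
    curvature g c t x ^ 2 = chartMetric (g t) p (chartPath n c p (x, t))
      (fderivWithin ℝ (chartPath n c p) (strip T) (x, t) (0, 1))
      (fderivWithin ℝ (chartPath n c p) (strip T) (x, t) (0, 1)) := by
  rw [hc.curvature_eq hT ht, hc.velocity_eq hT ht hp (hc.hasDerivWithinAt_chartPath ht hp),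
    ← chartMetric_chartPath (g t) hp, Real.sq_sqrt]
  rcases eq_or_ne (fderivWithin ℝ (chartPath n c p) (strip T) (x, t) (0, 1)) 0 with h0 | h0
  · rw [h0]; simp
  · exact (chartMetric_pos (g t) p ((extChartAt (𝓡 n) p).map_source hp) h0).le

theorem speed_eq (hc : IsCurveShrinkingFlow g T c) {x t : ℝ} {p : M}
    (ht : t ∈ Icc 0 T) (hp : position c (x, t) ∈ (extChartAt (𝓡 n) p).source) :
    speed g c t x = √(chartMetric (g t) p (chartPath n c p (x, t))
      (fderivWithin ℝ (chartPath n c p) (strip T) (x, t) (1, 0))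
      (fderivWithin ℝ (chartPath n c p) (strip T) (x, t) (1, 0))) := by
  rw [chartMetric_chartPath (g t) hp, ← hc.tangentVector_eq ht hp]
  rfl

theorem fderivWithin_chartPath_ne_zero (hc : IsCurveShrinkingFlow g T c) {x t : ℝ} {p : M}
    (ht : t ∈ Icc 0 T) (hp : position c (x, t) ∈ (extChartAt (𝓡 n) p).source) :
    fderivWithin ℝ (chartPath n c p) (strip T) (x, t) (1, 0) ≠ 0 := by
  intro h
  have h1 := hc.tangentVector_eq ht hp
  rw [h, map_zero] at h1
  exact hc.immersed t ht x h1

theorem speed_pos (hc : IsCurveShrinkingFlow g T c) {x t : ℝ} (ht : t ∈ Icc 0 T) :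
    0 < speed g c t x := by
  have hp : position c (x, t) ∈ (extChartAt (𝓡 n) (position c (x, t))).source :=
    mem_extChartAt_source _
  rw [hc.speed_eq ht hp]
  exact Real.sqrt_pos.2 (chartMetric_pos (g t) _ ((extChartAt (𝓡 n) _).map_source hp)
    (hc.fderivWithin_chartPath_ne_zero ht hp))

theorem curvature_periodic (hT : 0 < T) (hc : IsCurveShrinkingFlow g T c) {x t : ℝ}
    (ht : t ∈ Icc 0 T) : curvature g c t (x + 2 * Real.pi) = curvature g c t x := by
  rw [hc.curvature_eq hT ht, hc.curvature_eq hT ht]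
  have h1 : (fun s => position c (x + 2 * Real.pi, s)) = fun s => position c (x, s) :=
    funext fun s => position_add_two_pi c x s
  have h2 : velocity n T c (x + 2 * Real.pi, t) =
      velocity n T c (x, t) := by
    exact congrArg (fun σ : ℝ → M =>
      (mfderivWithin 𝓘(ℝ, ℝ) (𝓡 n) σ (Icc 0 T) t (1 : ℝ) : Coord n)) h1
  rw [h2, position_add_two_pi]

theorem speed_periodic (hc : IsCurveShrinkingFlow g T c) {x t : ℝ} (ht : t ∈ Icc 0 T) :
    speed g c t (x + 2 * Real.pi) = speed g c t x := by
  have hp : position c (x, t) ∈ (extChartAt (𝓡 n) (position c (x, t))).source :=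
    mem_extChartAt_source _
  have hp' : position c (x + 2 * Real.pi, t) ∈ (extChartAt (𝓡 n) (position c (x, t))).source := by
    rw [position_add_two_pi]; exact hp
  have h1 := (hc.hasDerivAt_chartPath ht hp').comp_add_const x (2 * Real.pi)
  have h2 : ∀ y, chartPath n c (position c (x, t)) (y + 2 * Real.pi, t) =
      chartPath n c (position c (x, t)) (y, t) := fun y => by
    rw [chartPath, chartPath, position_add_two_pi]
  simp only [h2] at h1
  rw [hc.speed_eq ht hp, hc.speed_eq ht hp', h1.unique (hc.hasDerivAt_chartPath ht hp), h2]

theorem contDiffWithinAt_metric (hg : IsRicciFlow g T) (hT : 0 < T)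
    (hc : IsCurveShrinkingFlow g T c) {z : ℝ × ℝ} {p : M} (hz : z ∈ strip T)
    (hp : position c z ∈ (extChartAt (𝓡 n) p).source) (a : ℝ × ℝ) :
    ContDiffWithinAt ℝ ∞ (fun w => chartMetric (g w.2) p (chartPath n c p w)
      (fderivWithin ℝ (chartPath n c p) (strip T) w a)
      (fderivWithin ℝ (chartPath n c p) (strip T) w a)) (strip T) z := by
  have h1 : ContDiffWithinAt ℝ ∞ (fun w => fderivWithin ℝ (chartPath n c p) (strip T) w a)
      (strip T) z :=
    ((hc.contDiffWithinAt_chartPath hz hp).fderivWithin_right (m := ∞) (uniqueDiffOn_strip hT)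
      (by simp) hz).clm_apply contDiffWithinAt_const
  have h2 : ContDiffWithinAt ℝ ∞ (fun w : ℝ × ℝ => chartMetric (g w.2) p (chartPath n c p w))
      (strip T) z := by
    refine ContDiffWithinAt.comp_of_preimage_mem_nhdsWithin
      (g := fun q : Coord n × ℝ => chartMetric (g q.2) p q.1)
      (f := fun w : ℝ × ℝ => (chartPath n c p w, w.2)) z
      (hg.smooth p (chartPath n c p z, z.2) ⟨(extChartAt (𝓡 n) p).map_source hp, hz.2⟩)
      ((hc.contDiffWithinAt_chartPath hz hp).prodMk contDiffWithinAt_snd) ?_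
    filter_upwards [hc.preimage_source_mem hz hp, self_mem_nhdsWithin] with w hw hwS
    exact ⟨(extChartAt (𝓡 n) p).map_source hw, hwS.2⟩
  exact (h2.clm_apply h1).clm_apply h1

/-- Near each point `k²` equals its expression in one fixed chart. The square is essential, since
`k` need not be smooth at its zeros. -/
theorem contDiffOn_curvature_sq (hg : IsRicciFlow g T) (hT : 0 < T)
    (hc : IsCurveShrinkingFlow g T c) :
    ContDiffOn ℝ ∞ (fun z => curvature g c z.2 z.1 ^ 2) (strip T) := by
  intro z hz
  have hp : position c z ∈ (extChartAt (𝓡 n) (position c z)).source := mem_extChartAt_source _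
  refine (hc.contDiffWithinAt_metric hg hT hz hp (0, 1)).congr_of_eventuallyEq ?_
    (hc.curvature_sq hT hz.2 hp)
  filter_upwards [hc.preimage_source_mem hz hp, self_mem_nhdsWithin] with w hw hwS
  exact hc.curvature_sq hT hwS.2 hw

theorem contDiffOn_speed (hg : IsRicciFlow g T) (hT : 0 < T)
    (hc : IsCurveShrinkingFlow g T c) :
    ContDiffOn ℝ ∞ (fun z => speed g c z.2 z.1) (strip T) := by
  intro z hz
  have hp : position c z ∈ (extChartAt (𝓡 n) (position c z)).source := mem_extChartAt_source _
  have h0 := chartMetric_pos (g z.2) _ ((extChartAt (𝓡 n) _).map_source hp)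
    (hc.fderivWithin_chartPath_ne_zero hz.2 hp)
  refine ((hc.contDiffWithinAt_metric hg hT hz hp (1, 0)).sqrt h0.ne').congr_of_eventuallyEq ?_
    (hc.speed_eq hz.2 hp)
  filter_upwards [hc.preimage_source_mem hz hp, self_mem_nhdsWithin] with w hw hwS
  exact hc.speed_eq hwS.2 hw

end IsCurveShrinkingFlow

end Flow

/-! ### From the flow on the manifold to the scalar inequalities. -/

section ChartDomain

variable {n : ℕ} {M : Type*} [TopologicalSpace M] [ChartedSpace (Coord n) M] {T : ℝ}
  {c : Circle → ℝ → M}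

/-- The interior space-time points that a flow maps to the domain of the chart at `p`. -/
def chartDomain (n : ℕ) {M : Type*} [TopologicalSpace M] [ChartedSpace (Coord n) M] (T : ℝ)
    (c : Circle → ℝ → M) (p : M) : Set (ℝ × ℝ) :=
  (univ ×ˢ Ioo 0 T) ∩ position c ⁻¹' (extChartAt (𝓡 n) p).source

theorem strip_mem_nhds_of_chartDomain {p : M} {z : ℝ × ℝ} (hz : z ∈ chartDomain n T c p) :
    strip T ∈ 𝓝 z :=
  strip_mem_nhds (x := z.1) (t := z.2) hz.1.2

theorem mem_strip_of_chartDomain {p : M} {z : ℝ × ℝ} (hz : z ∈ chartDomain n T c p) :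
    z ∈ strip T :=
  mem_of_mem_nhds (strip_mem_nhds_of_chartDomain hz)

end ChartDomain

section Main

variable {n : ℕ} {M : Type*} [TopologicalSpace M] [ChartedSpace (Coord n) M]
  [IsManifold (𝓡 n) ∞ M] {g : ℝ → Metric n M} {T : ℝ} {c : Circle → ℝ → M}

/-- The metrics `g(t)` in the chart at `p`, as a function of position and time. -/
def spacetimeMetric (g : ℝ → Metric n M) (p : M) (q : Coord n × ℝ) :
    Coord n →L[ℝ] Coord n →L[ℝ] ℝ :=
  chartMetric (g q.2) p q.1

/-- The Levi-Civita connections of `g(t)` in the chart at `p`. -/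
def spacetimeConn (g : ℝ → Metric n M) (T : ℝ) (p : M) :
    Coord n × ℝ → Coord n →L[ℝ] Coord n →L[ℝ] Coord n :=
  conn (spacetimeMetric g p) ((extChartAt (𝓡 n) p).target ×ˢ Icc 0 T)

/-- The bounds of the metric and its connection hold at all times at `y`, in the chart at `p`. -/
def IsBoundedInChart (g : ℝ → Metric n M) (T B : ℝ) (p : M) (y : Coord n) : Prop :=
  ∀ t ∈ Icc 0 T, IsBoundedAt B (spacetimeMetric g p (y, t))
    (fderivWithin ℝ (spacetimeMetric g p) ((extChartAt (𝓡 n) p).target ×ˢ Icc 0 T) (y, t))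
    (spacetimeConn g T p (y, t))
    (fderivWithin ℝ (spacetimeConn g T p) ((extChartAt (𝓡 n) p).target ×ˢ Icc 0 T) (y, t))

/-- On a compact manifold finitely many charts bound the geometry of the flow. -/
theorem IsRicciFlow.exists_constant [CompactSpace M] (hT : 0 < T) (hg : IsRicciFlow g T) :
    ∃ A : ℝ, 0 ≤ A ∧ ∀ m : M, ∃ (p : M) (B : ℝ), m ∈ (extChartAt (𝓡 n) p).source ∧
      IsBoundedInChart g T B p (extChartAt (𝓡 n) p m) ∧
      3 * B ^ 2 + 2 * (B ^ 4 * (2 + 2 * B)) ≤ A := by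
  have hK : ∀ p : M, ∃ K : Set (Coord n), IsCompact K ∧ extChartAt (𝓡 n) p p ∈ interior K ∧
      K ⊆ (extChartAt (𝓡 n) p).target := fun p =>
    exists_compact_subset (isOpen_extChartAt_target p) (mem_extChartAt_target p)
  choose K hKc hKi hKs using hK
  have hB : ∀ p : M, ∃ B, ∀ z ∈ K p ×ˢ Icc 0 T, IsBoundedAt B (spacetimeMetric g p z)
      (fderivWithin ℝ (spacetimeMetric g p) ((extChartAt (𝓡 n) p).target ×ˢ Icc 0 T) z)
      (spacetimeConn g T p z)
      (fderivWithin ℝ (spacetimeConn g T p) ((extChartAt (𝓡 n) p).target ×ˢ Icc 0 T) z) :=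
    fun p => (hg.isMetricFamily hT p).exists_bound ((hKc p).prod isCompact_Icc)
      (Set.prod_mono (hKs p) le_rfl)
  choose B hB using hB
  have hnhds : ∀ p : M,
      (extChartAt (𝓡 n) p).source ∩ extChartAt (𝓡 n) p ⁻¹' K p ∈ 𝓝 p := fun p =>
    inter_mem (extChartAt_source_mem_nhds p) ((continuousAt_extChartAt p).preimage_mem_nhds
      (mem_interior_iff_mem_nhds.1 (hKi p)))
  obtain ⟨s, hs⟩ := CompactSpace.elim_nhds_subcover _ hnhds
  -- The sum over the finite subcover dominates the error constant of each of its charts.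
  refine ⟨∑ p ∈ s, |3 * B p ^ 2 + 2 * (B p ^ 4 * (2 + 2 * B p))|,
    Finset.sum_nonneg fun p _ => abs_nonneg _, fun m => ?_⟩
  have hm : m ∈ ⋃ p ∈ s, (extChartAt (𝓡 n) p).source ∩ extChartAt (𝓡 n) p ⁻¹' K p := by
    rw [hs]; trivial
  simp only [mem_iUnion] at hm
  obtain ⟨p, hps, hmp⟩ := hm
  refine ⟨p, B p, hmp.1, fun t ht => hB p _ ⟨hmp.2, ht⟩, (le_abs_self _).trans ?_⟩
  exact Finset.single_le_sum (f := fun p => |3 * B p ^ 2 + 2 * (B p ^ 4 * (2 + 2 * B p))|)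
    (fun p _ => abs_nonneg _) hps

/-- The derivative of a slice of a field of bilinear forms in the second variable. -/
theorem hasDerivAt_slice {E : Type*} [NormedAddCommGroup E] [NormedSpace ℝ E]
    {G : E × ℝ → E →L[ℝ] E →L[ℝ] ℝ} {y : E} {t : ℝ} (hG : DifferentiableAt ℝ G (y, t)) (v w : E) :
    HasDerivAt (fun τ => G (y, τ) v w) (fderiv ℝ G (y, t) (0, 1) v w) t := by
  have hs : HasDerivAt (fun τ : ℝ => (y, τ)) ((0 : E), (1 : ℝ)) t :=
    (hasDerivAt_const t _).prodMk (hasDerivAt_id t)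
  have hd1 : HasDerivAt (G ∘ fun τ : ℝ => (y, τ)) (fderiv ℝ G (y, t) (0, 1)) t :=
    HasFDerivAt.comp_hasDerivAt (l := G) t hG.hasFDerivAt hs
  simpa using (hd1.clm_apply (hasDerivAt_const t v)).clm_apply (hasDerivAt_const t w)

/-- Under the Ricci flow the squared length of a unit vector increases at most at the rate `2 C`. -/
theorem IsRicciFlow.fderiv_time_le (hg : IsRicciFlow g T) (hT : 0 < T) {C : ℝ}
    (hC : RicciBoundedBy g T C) {p : M} {y : Coord n} (hy : y ∈ (extChartAt (𝓡 n) p).target)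
    {t : ℝ} (ht : t ∈ Ioo 0 T) {S : Coord n} (hS : spacetimeMetric g p (y, t) S S = 1) :
    fderiv ℝ (spacetimeMetric g p) (y, t) (0, 1) S S ≤ 2 * C := by
  have h1 := hasDerivAt_slice (((hg.smooth p).contDiffAt
    ((hg.isMetricFamily hT p).mem_nhds hy ht)).differentiableAt (by simp)) S S
  have h2 := (hg.evolution p y hy t (Ioo_subset_Icc_self ht) S S).hasDerivAt
    (Icc_mem_nhds ht.1 ht.2)
  have h4 := hC p y hy t (Ioo_subset_Icc_self ht) S S
  have hS' : chartMetric (g t) p y S S = 1 := hS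
  rw [hS', Real.sqrt_one, mul_one, mul_one] at h4
  generalize ricci (chartMetric (g t) p) y S S = ρ at h2 h4
  have h3 : fderiv ℝ (spacetimeMetric g p) (y, t) (0, 1) S S = -2 * ρ := h1.unique h2
  rw [h3]
  linarith [neg_le_of_abs_le h4]

namespace IsCurveShrinkingFlow

theorem isOpen_chartDomain (hc : IsCurveShrinkingFlow g T c) (p : M) :
    IsOpen (chartDomain n T c p) :=
  (hc.contMDiffOn_position.continuousOn.mono
    (Set.prod_mono le_rfl Ioo_subset_Icc_self)).isOpen_inter_preimage
    (isOpen_univ.prod isOpen_Ioo) (isOpen_extChartAt_source p)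

theorem contDiffOn_chartPath (hc : IsCurveShrinkingFlow g T c) (p : M) :
    ContDiffOn ℝ ∞ (chartPath n c p) (chartDomain n T c p) := fun _ hz =>
  (hc.contDiffWithinAt_chartPath (mem_strip_of_chartDomain hz) hz.2).mono
    fun _ hw => mem_strip_of_chartDomain hw

theorem speed_eq_dx (hc : IsCurveShrinkingFlow g T c) {p : M} {z : ℝ × ℝ}
    (hz : z ∈ chartDomain n T c p) :
    speed g c z.2 z.1 = √(spacetimeMetric g p (chartPath n c p z, z.2) (dx (chartPath n c p) z)
      (dx (chartPath n c p) z)) := by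
  have h := hc.speed_eq (x := z.1) (mem_strip_of_chartDomain hz).2 hz.2
  rwa [fderivWithin_of_mem_nhds (strip_mem_nhds_of_chartDomain hz)] at h

theorem curvature_sq_eq_dt (hT : 0 < T) (hc : IsCurveShrinkingFlow g T c) {p : M} {z : ℝ × ℝ}
    (hz : z ∈ chartDomain n T c p) :
    curvature g c z.2 z.1 ^ 2 = spacetimeMetric g p (chartPath n c p z, z.2)
      (dt (chartPath n c p) z) (dt (chartPath n c p) z) := by
  have h := hc.curvature_sq hT (x := z.1) (mem_strip_of_chartDomain hz).2 hz.2
  rwa [fderivWithin_of_mem_nhds (strip_mem_nhds_of_chartDomain hz)] at h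

theorem hasDerivAt_slice_chartPath (hc : IsCurveShrinkingFlow g T c) {p : M} {x t : ℝ}
    (hz : (x, t) ∈ chartDomain n T c p) :
    HasDerivAt (fun y => chartPath n c p (y, t)) (dx (chartPath n c p) (x, t)) x := by
  have h := hc.hasDerivAt_chartPath (mem_strip_of_chartDomain hz).2 hz.2
  rwa [fderivWithin_of_mem_nhds (strip_mem_nhds_of_chartDomain hz)] at h

theorem unitTangent_eq (hc : IsCurveShrinkingFlow g T c) {p : M} {x t : ℝ}
    (hz : (x, t) ∈ chartDomain n T c p) :
    unitTangent (chartMetric (g t) p) (chartCurve c p t) x =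
      unitField (fun z => speed g c z.2 z.1) (chartPath n c p) (x, t) := by
  have h1 : deriv (chartCurve c p t) x = dx (chartPath n c p) (x, t) :=
    (hc.hasDerivAt_slice_chartPath hz).deriv
  rw [unitTangent, unitField, h1, hc.speed_eq_dx hz]
  rfl

/-- Matches `curvatureVector`, written with derivatives of a curve at a fixed time, to the covariant
derivative in space-time that the local theory uses. -/
theorem dt_chartPath_eq (hg : IsRicciFlow g T) (hT : 0 < T) (hc : IsCurveShrinkingFlow g T c)
    {p : M} {z : ℝ × ℝ} (hz : z ∈ chartDomain n T c p) :
    dt (chartPath n c p) z = (speed g c z.2 z.1)⁻¹ • covD (spacetimeConn g T p) (chartPath n c p)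
      (1, 0) (unitField (fun z => speed g c z.2 z.1) (chartPath n c p)) z := by
  obtain ⟨x, t⟩ := z
  have htI : t ∈ Icc 0 T := (mem_strip_of_chartDomain hz).2
  have hsm : ContDiffOn ℝ ∞ (unitField (fun z => speed g c z.2 z.1) (chartPath n c p))
      (chartDomain n T c p) :=
    (((hc.contDiffOn_speed hg hT).mono fun _ hw => mem_strip_of_chartDomain hw).inv fun w hw =>
      (hc.speed_pos (mem_strip_of_chartDomain hw).2).ne').smul
      (contDiffOn_fderiv_apply (hc.isOpen_chartDomain p) (hc.contDiffOn_chartPath p) _)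
  have h1 := hc.hasDerivWithinAt_chartPath htI hz.2
  rw [fderivWithin_of_mem_nhds (strip_mem_nhds_of_chartDomain hz)] at h1
  have h2 := hc.evolution p t htI x hz.2
  have h3 : dt (chartPath n c p) (x, t) =
      curvatureVector (chartMetric (g t) p) (chartCurve c p t) x :=
    (uniqueDiffOn_Icc hT t htI).eq_deriv _ h1 h2
  have h4 : unitTangent (chartMetric (g t) p) (chartCurve c p t) =ᶠ[𝓝 x]
      fun y => unitField (fun z => speed g c z.2 z.1) (chartPath n c p) (y, t) := by
    have : ∀ᶠ y in 𝓝 x, (y, t) ∈ chartDomain n T c p :=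
      (by fun_prop : Continuous fun y : ℝ => (y, t)).continuousAt.eventually_mem
        ((hc.isOpen_chartDomain p).mem_nhds hz)
    exact this.mono fun y hy => hc.unitTangent_eq hy
  have h5 : deriv (unitTangent (chartMetric (g t) p) (chartCurve c p t)) x =
      dx (unitField (fun z => speed g c z.2 z.1) (chartPath n c p)) (x, t) := by
    rw [h4.deriv_eq]
    exact (hasDerivAt_slice_fst ((hsm.contDiffAt
      ((hc.isOpen_chartDomain p).mem_nhds hz)).differentiableAt (by simp))).deriv
  have h6 : √(chartMetric (g t) p (chartCurve c p t x) (deriv (chartCurve c p t) x)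
      (deriv (chartCurve c p t) x)) = speed g c t x := by
    have h7 : deriv (chartCurve c p t) x = dx (chartPath n c p) (x, t) :=
      (hc.hasDerivAt_slice_chartPath hz).deriv
    rw [h7]
    exact (hc.speed_eq_dx hz).symm
  have h8 : ∀ v w, christoffel (chartMetric (g t) p) (chartCurve c p t x) v w =
      spacetimeConn g T p (chartPath n c p (x, t), t) v w := fun v w =>
    (hg.isMetricFamily hT p).christoffel_eq ((extChartAt (𝓡 n) p).map_source hz.2) htI v w
  have h9 : ∀ S, spacetimeConn g T p (chartPath n c p (x, t), t)
      ((speed g c t x)⁻¹ • dx (chartPath n c p) (x, t)) S = (speed g c t x)⁻¹ •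
      spacetimeConn g T p (chartPath n c p (x, t), t) (dx (chartPath n c p) (x, t)) S := fun S => by
    rw [map_smul, _root_.smul_apply]
  rw [h3, curvatureVector, h5, h6, h8, hc.unitTangent_eq hz, covD, smul_add]
  congr 1
  exact h9 _

theorem isLocalFlow (hg : IsRicciFlow g T) (hT : 0 < T) (hc : IsCurveShrinkingFlow g T c)
    (p : M) :
    IsLocalFlow (chartDomain n T c p) (spacetimeMetric g p) (spacetimeConn g T p)
      (chartPath n c p) (fun z => speed g c z.2 z.1) where
  isOpen := hc.isOpen_chartDomain p
  contDiffOn := hc.contDiffOn_chartPath p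
  contDiffAt_metric z hz := (hg.smooth p).contDiffAt
    ((hg.isMetricFamily hT p).mem_nhds ((extChartAt (𝓡 n) p).map_source hz.2) hz.1.2)
  contDiffAt_conn z hz := (hg.isMetricFamily hT p).contDiffOn_conn.contDiffAt
    ((hg.isMetricFamily hT p).mem_nhds ((extChartAt (𝓡 n) p).map_source hz.2) hz.1.2)
  symm z _ u w := chartMetric_symm _ p _ u w
  pos z hz u hu := chartMetric_pos _ p ((extChartAt (𝓡 n) p).map_source hz.2) hu
  conn_symm z hz u w := (hg.isMetricFamily hT p).conn_symm
    ⟨(extChartAt (𝓡 n) p).map_source hz.2, (mem_strip_of_chartDomain hz).2⟩ u w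
  compat z hz u v w := by
    have h := (hg.isMetricFamily hT p).compat (z := (chartPath n c p z, z.2))
      ⟨(extChartAt (𝓡 n) p).map_source hz.2, (mem_strip_of_chartDomain hz).2⟩ u v w
    have h' : fderivWithin ℝ (spacetimeMetric g p) ((extChartAt (𝓡 n) p).target ×ˢ Icc 0 T)
        (chartPath n c p z, z.2) = fderiv ℝ (spacetimeMetric g p) (chartPath n c p z, z.2) :=
      fderivWithin_of_mem_nhds ((hg.isMetricFamily hT p).mem_nhds
        ((extChartAt (𝓡 n) p).map_source hz.2) hz.1.2)
    rw [← h']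
    exact h
  immersed z hz := by
    have h := hc.fderivWithin_chartPath_ne_zero (x := z.1) (mem_strip_of_chartDomain hz).2 hz.2
    rwa [fderivWithin_of_mem_nhds (strip_mem_nhds_of_chartDomain hz)] at h
  speed_eq z hz := hc.speed_eq_dx hz
  evolution z hz := hc.dt_chartPath_eq hg hT hz

/-- The tangent of the immersed curve is a nonzero vector on which to test the Ricci bound. -/
theorem bound_nonneg (hT : 0 < T) (hc : IsCurveShrinkingFlow g T c) {C : ℝ}
    (hC : RicciBoundedBy g T C) : 0 ≤ C := by
  have hp : position c (0, 0) ∈ (extChartAt (𝓡 n) (position c (0, 0))).source :=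
    mem_extChartAt_source _
  have h0 : (0 : ℝ) ∈ Icc 0 T := ⟨le_rfl, hT.le⟩
  have hy := (extChartAt (𝓡 n) _).map_source hp
  have hX := hc.fderivWithin_chartPath_ne_zero h0 hp
  have h1 := (abs_nonneg _).trans (hC _ _ hy 0 h0 (fderivWithin ℝ (chartPath n c
    (position c (0, 0))) (strip T) (0, 0) (1, 0)) (fderivWithin ℝ (chartPath n c
    (position c (0, 0))) (strip T) (0, 0) (1, 0)))
  have h2 := Real.sqrt_pos.2 (chartMetric_pos (g 0) _ hy hX)
  rw [mul_assoc] at h1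
  exact nonneg_of_mul_nonneg_left h1 (mul_pos h2 h2)

theorem dt_speed_le (hg : IsRicciFlow g T) (hT : 0 < T) (hc : IsCurveShrinkingFlow g T c) {C : ℝ}
    (hC : RicciBoundedBy g T C) {x t : ℝ} (ht : t ∈ Ioo 0 T) :
    dt (fun z => speed g c z.2 z.1) (x, t) ≤ speed g c t x * (C - curvature g c t x ^ 2) := by
  obtain ⟨p, hz⟩ : ∃ p, (x, t) ∈ chartDomain n T c p :=
    ⟨position c (x, t), ⟨mem_univ _, ht⟩, mem_extChartAt_source _⟩
  have hl := hc.isLocalFlow hg hT p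
  have hy : chartPath n c p (x, t) ∈ (extChartAt (𝓡 n) p).target :=
    (extChartAt (𝓡 n) p).map_source hz.2
  have h1 := hg.fderiv_time_le hT hC hy ht (hl.inner_unitField hz)
  have h2 := hl.dt_speed hz
  have h3 := hc.curvature_sq_eq_dt hT hz
  have h4 : 0 ≤ speed g c t x := (hc.speed_pos (Ioo_subset_Icc_self ht)).le
  rw [h2]
  refine mul_le_mul_of_nonneg_left ?_ h4
  rw [h3]
  linarith

/-- The speed and the squared curvature of a curve-shrinking flow satisfy the scalar evolution
inequalities. -/
theorem isEvolution (hg : IsRicciFlow g T) (hT : 0 < T) (hc : IsCurveShrinkingFlow g T c)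
    {A C : ℝ} (hC : RicciBoundedBy g T C)
    (hA : ∀ m : M, ∃ (p : M) (B : ℝ), m ∈ (extChartAt (𝓡 n) p).source ∧
      IsBoundedInChart g T B p (extChartAt (𝓡 n) p m) ∧
      3 * B ^ 2 + 2 * (B ^ 4 * (2 + 2 * B)) ≤ A) :
    IsEvolution T C A (fun z => speed g c z.2 z.1) (fun z => curvature g c z.2 z.1 ^ 2) where
  contDiffOn_speed := hc.contDiffOn_speed hg hT
  contDiffOn_curv := hc.contDiffOn_curvature_sq hg hT
  speed_pos z hz := hc.speed_pos hz.2
  curv_nonneg z _ := sq_nonneg _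
  periodic_speed x t ht := hc.speed_periodic ht
  periodic_curv x t ht := by simp only [hc.curvature_periodic hT ht]
  speed_le x t ht := hc.dt_speed_le hg hT hC ht
  curv_le x t ht := by
    -- The chart is the one supplied with controlled bounds, not the chart at the point itself.
    obtain ⟨p, B, hm, hB, hBA⟩ := hA (position c (x, t))
    have hz : (x, t) ∈ chartDomain n T c p := ⟨⟨mem_univ _, ht⟩, hm⟩
    have hl := hc.isLocalFlow hg hT p
    have hn := (hg.isMetricFamily hT p).mem_nhds ((extChartAt (𝓡 n) p).map_source hm) ht
    have hB' := hB t (Ioo_subset_Icc_self ht)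
    rw [fderivWithin_of_mem_nhds hn, fderivWithin_of_mem_nhds hn] at hB'
    obtain ⟨Q, hQ, h1, h2⟩ := hl.dt_curv_le hz hB'
    have hW := (hc.isOpen_chartDomain p).mem_nhds hz
    have e : (fun z => curvature g c z.2 z.1 ^ 2) =ᶠ[𝓝 (x, t)] fun w =>
        spacetimeMetric g p (chartPath n c p w, w.2) (dt (chartPath n c p) w)
          (dt (chartPath n c p) w) :=
      eventually_of_mem hW fun w hw => hc.curvature_sq_eq_dt hT hw
    -- The second derivative requires the first derivatives to agree on a neighbourhood, not only at
    -- the point.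
    have e1 : (fun w : ℝ × ℝ => (speed g c w.2 w.1)⁻¹ *
        dx (fun z => curvature g c z.2 z.1 ^ 2) w) =ᶠ[𝓝 (x, t)] fun y =>
        (speed g c y.2 y.1)⁻¹ * dx (fun w => spacetimeMetric g p (chartPath n c p w, w.2)
          (dt (chartPath n c p) w) (dt (chartPath n c p) w)) y :=
      (e.fderiv (𝕜 := ℝ)).mono fun w hw => by simp only [dx, hw]
    refine ⟨Q, hQ, ?_, ?_⟩
    · rw [dx, e.fderiv_eq, e.eq_of_nhds]
      exact h1
    · rw [dt, dx, e.fderiv_eq, e1.fderiv_eq, e.eq_of_nhds]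
      refine h2.trans (add_le_add_right (mul_le_mul_of_nonneg_right hBA ?_) _)
      have := e.eq_of_nhds
      simp only at this
      rw [← this]
      positivity

end IsCurveShrinkingFlow

end Main

end RicciCSF

end

/-! ### Conclusion. -/

theorem mainTheorem3 {n : ℕ} {M : Type*} [TopologicalSpace M] [ChartedSpace (RicciCSF.Coord n) M]
    [IsManifold (𝓡 n) ∞ M] [CompactSpace M] [T2Space M]
    (T : ℝ) (hT : 0 < T) (g : ℝ → RicciCSF.Metric n M) (hg : RicciCSF.IsRicciFlow g T) :
    ∃ C₁ : ℝ, 0 ≤ C₁ ∧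
      ∀ C₂ : ℝ, RicciCSF.RicciBoundedBy g T C₂ →
      ∀ c : Circle → ℝ → M, RicciCSF.IsCurveShrinkingFlow g T c →
        (∀ t ∈ Icc 0 T,
          DifferentiableWithinAt ℝ (RicciCSF.length g c) (Icc 0 T) t ∧
          derivWithin (RicciCSF.length g c) (Icc 0 T) t ≤
            ∫ x in (0 : ℝ)..2 * Real.pi,
              (C₂ - RicciCSF.curvature g c t x ^ 2) * RicciCSF.speed g c t x) ∧
        ContinuousOn (RicciCSF.totalCurvature g c) (Icc 0 T) ∧
        (∀ t ∈ Icc 0 T,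
          RicciCSF.DerivLEWithin (RicciCSF.totalCurvature g c)
            ((C₁ + C₂) * RicciCSF.totalCurvature g c t + C₁ * RicciCSF.length g c t)
            (Icc 0 T) t) ∧
        (∀ t ∈ Icc 0 T,
          RicciCSF.length g c t ≤ RicciCSF.length g c 0 * Real.exp (C₂ * t)) ∧
        (∀ t ∈ Icc 0 T,
          RicciCSF.totalCurvature g c t + RicciCSF.length g c t ≤
            (RicciCSF.totalCurvature g c 0 + RicciCSF.length g c 0) *
              Real.exp ((C₁ + C₂) * t)) := by
  -- `A` is fixed before `C₂` and the curve are introduced, so it depends on the ambient flow alone.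
  obtain ⟨A, hA0, hA⟩ := hg.exists_constant hT
  refine ⟨A, hA0, fun C hC c hc => ?_⟩
  have hev := hc.isEvolution hg hT hC hA
  have hC0 := hc.bound_nonneg hT hC
  have hlen : RicciCSF.length g c =
      fun t => ∫ x in (0 : ℝ)..2 * Real.pi, RicciCSF.speed g c t x := rfl
  -- The scalar results are stated for the smooth function `f = k²`, so `k` is rewritten as `√(k²)`.
  have htot : RicciCSF.totalCurvature g c = fun t => ∫ x in (0 : ℝ)..2 * Real.pi,
      √(RicciCSF.curvature g c t x ^ 2) * RicciCSF.speed g c t x := by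
    funext t
    refine intervalIntegral.integral_congr fun x _ => ?_
    have h0 : 0 ≤ RicciCSF.curvature g c t x := Real.sqrt_nonneg _
    change RicciCSF.curvature g c t x * _ = √(RicciCSF.curvature g c t x ^ 2) * _
    rw [Real.sqrt_sq h0]
  rw [hlen, htot]
  refine ⟨fun t ht => ?_, hev.continuousOn_totalCurvature hT,
    fun t ht => hev.totalCurvature_derivLE hT hA0 hC0 ht, fun t ht => hev.length_le hT ht,
    fun t ht => hev.totalCurvature_add_length_le hT hA0 hC0 ht⟩
  obtain ⟨d, hd, hle⟩ := hev.length_deriv hT ht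
  exact ⟨hd.differentiableWithinAt, (hd.derivWithin (uniqueDiffOn_Icc hT t ht)).trans_le hle⟩
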